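/- Let $\alpha,\beta\in\mathbb R$ and, for $k\in[0,2\pi)$, let $\eta(k)=\overline{\langle 0|H_\alpha D_kH_\beta|1\rangle}=-\cos k\,\sin(\alpha+\beta)+i\sin k\,\sin(\alpha-\beta)$, where $H_\gamma=\begin{pmatrix}\cos\gamma&-\sin\gamma\\ \sin\gamma&\cos\gamma\end{pmatrix}$ and $D_k=\mathrm{diag}(e^{-ik},e^{ik})$. Then $|\eta(k)|\le 1$. Let $\mathcal C_k$ be the operator on $\ell^2(\mathbb Z_+)$ given by the CMV matrix with Verblunsky parameters $(\eta(k),0,\eta(k),0,\dots)$. Let $\sigma_p^{(k)}$ be the set of eigenvalues of $\mathcal C_k$, and let $\sigma_c^{(k)}$ be its continuous spectrum, that is, the set of $z$ for which $\mathcal C_k-z$ is injective with dense range but not onto. Put $K=\{k\in[0,2\pi): |\eta(k)|<1\}$, $$Bu=\{(k,\theta)\in K\times[0,2\pi): e^{i\theta}\in\sigma_c^{(k)}\},\qquad Ed=\{(k,\theta)\in K\times[0,2\pi): e^{i\theta}\in\sigma_p^{(k)}\},$$ $$\theta_c(k)=\arccos\sqrt{\cos^2(\alpha-\beta)-\sin2\alpha\,\sin2\beta\,\cos^2k},\qquad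 B(k)=[\theta_c(k),\pi-\theta_c(k)]\cup[\pi+\theta_c(k),2\pi-\theta_c(k)],$$ $$\theta_0(k)=\begin{cases}\arcsin(-\sin k\sin(\alpha-\beta)),&\cos k\,\sin(\alpha+\beta)\le 0,\\ \pi-\arcsin(-\sin k\sin(\alpha-\beta)),&\cos k\,\sin(\alpha+\beta)>0.\end{cases}$$ Then: (1) $Bu=\bigcup_{k\in K}\{k\}\times\bigl(B(k)\cap[0,2\pi)\bigr)$. (2) If $\sin(\alpha+\beta)\ne0$, then $Ed=\{(k,\theta_0(k)\bmod 2\pi): k\in K\setminus\{\pi/2,3\pi/2\}\}$; if $\sin(\alpha+\beta)=0$, then $Ed=\emptyset$. (3) For every $k\in K$, $\sigma(\mathcal C_k)=\sigma_c^{(k)}\sqcup\sigma_p^{(k)}$ with $\sigma_c^{(k)}=\{e^{i\theta}:\theta\in B(k)\}$, and $\sigma_p^{(k)}=\{e^{i\theta_0(k)}\}$ if $\sin(\alpha+\beta)\neq0$ and $k\notin\{\pi/2,3\pi/2\}$, $\sigma_p^{(k)}=\emptyset$ otherwise. (4) For the remaining $k\in[0,2\pi)$, those with $|\eta(k)|=1$,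 one has $\sigma_c^{(k)}=\emptyset$ and $\sigma(\mathcal C_k)=\sigma_p^{(k)}$; the eigenvalues of infinite multiplicity are exactly the points $e^{i\theta}$ with $\theta\in B(k)=\{\pi/2,3\pi/2\}$, and the set of eigenvalues of finite multiplicity is $\{e^{i\theta_0(k)}\}$ if $\sin(\alpha+\beta)\neq0$ and $k\notin\{\pi/2,3\pi/2\}$, and empty otherwise. -/

import Mathlib

namespace AEWalk

open Set

noncomputable section

/-! ### The CMV matrix on `ℓ²(ℤ₊)` -/

/-- The Hilbert space `ℓ²(ℤ₊)`. -/
abbrev HalfLine : Type := lp (fun _ : ℕ => ℂ) 2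

/-- `ρ_j = √(1 - |a_j|²)`. -/
def cmvRho (a : ℕ → ℂ) (j : ℕ) : ℝ := √(1 - ‖a j‖ ^ 2)

/-- The parameter preceding `a_n`, with the usual convention `a_{-1} = -1`. -/
def prevParam (a : ℕ → ℂ) : ℕ → ℂ
  | 0 => -1
  | n + 1 => a n

/-- `√(1 - |a_{n-1}|²)`, which is `0` for `n = 0`. -/
def prevRho (a : ℕ → ℂ) : ℕ → ℝ
  | 0 => 0
  | n + 1 => cmvRho a n

/-- The CMV matrix with Verblunsky parameters `a`. With `a_{-1} = -1` its rows are
* row `n` even: columns `n-1, n, n+1, n+2` are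
  `ρ_{n-1} ā_n`, `-a_{n-1} ā_n`, `ρ_n ā_{n+1}`, `ρ_n ρ_{n+1}`;
* row `n+1` with `n` even: columns `n-1, n, n+1, n+2` are
  `ρ_{n-1} ρ_n`, `-a_{n-1} ρ_n`, `-a_n ā_{n+1}`, `-a_n ρ_{n+1}`. -/
def cmvMatrix (a : ℕ → ℂ) : Matrix ℕ ℕ ℂ := fun i j =>
  if Even i then
    if j + 1 = i then (prevRho a i : ℂ) * star (a i)
    else if j = i then -prevParam a i * star (a i)
    else if j = i + 1 then (cmvRho a i : ℂ) * star (a (i + 1))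
    else if j = i + 2 then (cmvRho a i : ℂ) * (cmvRho a (i + 1) : ℂ)
    else 0
  else
    if j + 2 = i then (prevRho a (i - 1) : ℂ) * (cmvRho a (i - 1) : ℂ)
    else if j + 1 = i then -prevParam a (i - 1) * (cmvRho a (i - 1) : ℂ)
    else if j = i then -a (i - 1) * star (a i)
    else if j = i + 1 then -a (i - 1) * (cmvRho a i : ℂ)
    else 0

theorem cmvRho_norm_le (a : ℕ → ℂ) (j : ℕ) : ‖(cmvRho a j : ℂ)‖ ≤ 1 := by
  rw [Complex.norm_real, cmvRho, Real.norm_of_nonneg (Real.sqrt_nonneg _)]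
  exact Real.sqrt_le_one.mpr (by nlinarith [sq_nonneg ‖a j‖])

theorem prevRho_norm_le (a : ℕ → ℂ) (j : ℕ) : ‖(prevRho a j : ℂ)‖ ≤ 1 := by
  cases j with
  | zero => simp [prevRho]
  | succ n => exact cmvRho_norm_le a n

theorem prevParam_norm_le (a : ℕ → ℂ) (ha : ∀ j, ‖a j‖ ≤ 1) (j : ℕ) :
    ‖prevParam a j‖ ≤ 1 := by
  cases j with
  | zero => simp [prevParam]
  | succ n => exact ha n

theorem norm_mul_le_one_of {x y : ℂ} (hx : ‖x‖ ≤ 1) (hy : ‖y‖ ≤ 1) : ‖x * y‖ ≤ 1 := by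
  rw [norm_mul]
  exact mul_le_one₀ hx (norm_nonneg _) hy

theorem cmvMatrix_norm_le (a : ℕ → ℂ) (ha : ∀ j, ‖a j‖ ≤ 1) (i j : ℕ) :
    ‖cmvMatrix a i j‖ ≤ 1 := by
  have hs : ∀ n, ‖star (a n)‖ ≤ 1 := fun n => by rw [norm_star]; exact ha n
  have hn : ∀ n, ‖-a n‖ ≤ 1 := fun n => by rw [norm_neg]; exact ha n
  have hp : ∀ n, ‖-prevParam a n‖ ≤ 1 := fun n => by
    rw [norm_neg]; exact prevParam_norm_le a ha n
  have hr := cmvRho_norm_le a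
  have hq := prevRho_norm_le a
  unfold cmvMatrix
  split_ifs
  all_goals first
    | exact norm_mul_le_one_of (hq _) (hs _)
    | exact norm_mul_le_one_of (hp _) (hs _)
    | exact norm_mul_le_one_of (hr _) (hs _)
    | exact norm_mul_le_one_of (hr _) (hr _)
    | exact norm_mul_le_one_of (hq _) (hr _)
    | exact norm_mul_le_one_of (hp _) (hr _)
    | exact norm_mul_le_one_of (hn _) (hs _)
    | exact norm_mul_le_one_of (hn _) (hr _)
    | simp

theorem cmvMatrix_eq_zero (a : ℕ → ℂ) (i j : ℕ) (h : j + 2 < i) : cmvMatrix a i j = 0 := by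
  unfold cmvMatrix
  split_ifs <;> first | rfl | omega

/-- `(C f)_i = ∑_j C_{ij} f_j`; row `i` of `C` vanishes beyond column `i + 2`. -/
def cmvApply (a : ℕ → ℂ) (f : ℕ → ℂ) (i : ℕ) : ℂ :=
  ∑ j ∈ Finset.range (i + 3), cmvMatrix a i j * f j

theorem cmvApply_norm_sq_le (a : ℕ → ℂ) (ha : ∀ j, ‖a j‖ ≤ 1) (f : ℕ → ℂ) (i : ℕ) :
    ‖cmvApply a f i‖ ^ 2 ≤ 5 * ∑ j ∈ Finset.Icc (i - 2) (i + 2), ‖f j‖ ^ 2 := by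
  have h1 : cmvApply a f i = ∑ j ∈ Finset.Icc (i - 2) (i + 2), cmvMatrix a i j * f j := by
    unfold cmvApply
    symm
    apply Finset.sum_subset
    · intro j hj
      simp only [Finset.mem_Icc, Finset.mem_range] at hj ⊢
      omega
    · intro j hj hj'
      simp only [Finset.mem_Icc, Finset.mem_range] at hj hj'
      rw [cmvMatrix_eq_zero a i j (by omega), zero_mul]
  have h2 : ‖cmvApply a f i‖ ≤ ∑ j ∈ Finset.Icc (i - 2) (i + 2), ‖f j‖ := by
    rw [h1]
    refine (norm_sum_le _ _).trans (Finset.sum_le_sum fun j _ => ?_)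
    rw [norm_mul]
    exact mul_le_of_le_one_left (norm_nonneg _) (cmvMatrix_norm_le a ha i j)
  have h3 : (∑ j ∈ Finset.Icc (i - 2) (i + 2), ‖f j‖) ^ 2
      ≤ ((Finset.Icc (i - 2) (i + 2)).card : ℝ)
        * ∑ j ∈ Finset.Icc (i - 2) (i + 2), ‖f j‖ ^ 2 := sq_sum_le_card_mul_sum_sq
  have h4 : ((Finset.Icc (i - 2) (i + 2)).card : ℝ) ≤ 5 := by
    rw [Nat.card_Icc]
    exact_mod_cast (by omega : i + 2 + 1 - (i - 2) ≤ 5)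
  calc ‖cmvApply a f i‖ ^ 2 ≤ (∑ j ∈ Finset.Icc (i - 2) (i + 2), ‖f j‖) ^ 2 :=
        pow_le_pow_left₀ (norm_nonneg _) h2 2
    _ ≤ _ := h3
    _ ≤ _ := mul_le_mul_of_nonneg_right h4 (Finset.sum_nonneg fun _ _ => sq_nonneg _)

theorem cmvApply_sum_le (a : ℕ → ℂ) (ha : ∀ j, ‖a j‖ ≤ 1) (f : HalfLine) (s : Finset ℕ) :
    ∑ i ∈ s, ‖cmvApply a f i‖ ^ 2 ≤ (5 * ‖f‖) ^ 2 := by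
  classical
  have hf : ∀ t : Finset ℕ, ∑ j ∈ t, ‖f j‖ ^ 2 ≤ ‖f‖ ^ 2 := fun t => by
    have h := lp.sum_rpow_le_norm_rpow (p := 2) (by norm_num) f t
    simpa using h
  let t : Finset ℕ := s.biUnion fun i => Finset.Icc (i - 2) (i + 2)
  calc ∑ i ∈ s, ‖cmvApply a f i‖ ^ 2
      ≤ ∑ i ∈ s, 5 * ∑ j ∈ Finset.Icc (i - 2) (i + 2), ‖f j‖ ^ 2 :=
        Finset.sum_le_sum fun i _ => cmvApply_norm_sq_le a ha f i
    _ = 5 * ∑ i ∈ s, ∑ j ∈ Finset.Icc (i - 2) (i + 2), ‖f j‖ ^ 2 := by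
        rw [Finset.mul_sum]
    _ = 5 * ∑ j ∈ t, ∑ i ∈ s with j ∈ Finset.Icc (i - 2) (i + 2), ‖f j‖ ^ 2 := by
        congr 1
        refine Finset.sum_comm' fun i j => ?_
        simp only [Finset.mem_filter, t, Finset.mem_biUnion]
        exact ⟨fun h => ⟨⟨h.1, h.2⟩, i, h.1, h.2⟩, fun h => ⟨h.1.1, h.1.2⟩⟩
    _ ≤ 5 * ∑ j ∈ t, 5 * ‖f j‖ ^ 2 := by
        refine mul_le_mul_of_nonneg_left (Finset.sum_le_sum fun j _ => ?_) (by norm_num)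
        rw [Finset.sum_const, nsmul_eq_mul]
        refine mul_le_mul_of_nonneg_right ?_ (sq_nonneg _)
        have hsub : (s.filter fun i => j ∈ Finset.Icc (i - 2) (i + 2))
            ⊆ Finset.Icc (j - 2) (j + 2) := by
          intro i hi
          simp only [Finset.mem_filter, Finset.mem_Icc] at hi ⊢
          omega
        have hc := Finset.card_le_card hsub
        rw [Nat.card_Icc] at hc
        exact_mod_cast (by omega : (s.filter fun i => j ∈ Finset.Icc (i - 2) (i + 2)).card ≤ 5)
    _ = 25 * ∑ j ∈ t, ‖f j‖ ^ 2 := by rw [← Finset.mul_sum]; ring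
    _ ≤ 25 * ‖f‖ ^ 2 := mul_le_mul_of_nonneg_left (hf t) (by norm_num)
    _ = (5 * ‖f‖) ^ 2 := by ring

theorem cmvApply_memℓp (a : ℕ → ℂ) (ha : ∀ j, ‖a j‖ ≤ 1) (f : HalfLine) :
    Memℓp (cmvApply a f) 2 := by
  refine memℓp_gen' (C := (5 * ‖f‖) ^ 2) fun s => ?_
  simpa using cmvApply_sum_le a ha f s

/-- The bounded operator on `ℓ²(ℤ₊)` given by the CMV matrix with Verblunsky parameters `a`. -/
def cmv (a : ℕ → ℂ) (ha : ∀ j, ‖a j‖ ≤ 1) : HalfLine →L[ℂ] HalfLine :=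
  LinearMap.mkContinuous
    { toFun := fun f => ⟨cmvApply a f, cmvApply_memℓp a ha f⟩
      map_add' := fun f g => by
        ext i
        change cmvApply a (f + g) i = cmvApply a f i + cmvApply a g i
        simp [cmvApply, mul_add, Finset.sum_add_distrib]
      map_smul' := fun c f => by
        ext i
        simp [cmvApply, Finset.mul_sum, mul_left_comm] }
    5
    (fun f => by
      refine lp.norm_le_of_forall_sum_le (p := 2) (by norm_num) (by positivity) fun s => ?_
      simpa using cmvApply_sum_le a ha f s)

/-! ### Spectra of a bounded operator -/

/-- The point spectrum: the set of eigenvalues. -/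
def pointSpectrum (T : HalfLine →L[ℂ] HalfLine) : Set ℂ :=
  {z | Module.End.HasEigenvalue (T : HalfLine →ₗ[ℂ] HalfLine) z}

/-- The continuous spectrum: `T - z` is injective with dense range, but not onto. -/
def continuousSpectrum (T : HalfLine →L[ℂ] HalfLine) : Set ℂ :=
  {z | Function.Injective (T - z • ContinuousLinearMap.id ℂ HalfLine) ∧
    DenseRange (T - z • ContinuousLinearMap.id ℂ HalfLine) ∧
    ¬ Function.Surjective (T - z • ContinuousLinearMap.id ℂ HalfLine)}

/-! ### The AE model at a fixed wave number -/

/-- The rotation matrix `H_γ`. -/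
def rot (γ : ℝ) : Matrix (Fin 2) (Fin 2) ℂ :=
  !![(Real.cos γ : ℂ), -(Real.sin γ : ℂ); (Real.sin γ : ℂ), (Real.cos γ : ℂ)]

/-- The matrix `D_k = diag(e^{-ik}, e^{ik})`. -/
def phase (k : ℝ) : Matrix (Fin 2) (Fin 2) ℂ :=
  !![Complex.exp (-(Complex.I * k)), 0; 0, Complex.exp (Complex.I * k)]

/-- The quantum coin `H_α D_k H_β` at wave number `k`. -/
def coin (α β k : ℝ) : Matrix (Fin 2) (Fin 2) ℂ := rot α * phase k * rot β

/-- The Verblunsky parameter `η(k)`: the conjugate of the upper right entry of the coin. -/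
def eta (α β k : ℝ) : ℂ := star (coin α β k 0 1)

theorem eta_eq (α β k : ℝ) :
    eta α β k = ⟨-(Real.cos k * Real.sin (α + β)), Real.sin k * Real.sin (α - β)⟩ := by
  have h0 : ∀ t : ℝ, Complex.exp (t * Complex.I) = ⟨Real.cos t, Real.sin t⟩ := fun t =>
    Complex.ext (Complex.exp_ofReal_mul_I_re t) (Complex.exp_ofReal_mul_I_im t)
  have h1 : Complex.exp (Complex.I * k) = ⟨Real.cos k, Real.sin k⟩ := by rw [mul_comm, h0]
  have h2 : Complex.exp (-(Complex.I * k)) = ⟨Real.cos k, -Real.sin k⟩ := by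
    have h : -(Complex.I * (k : ℂ)) = ((-k : ℝ) : ℂ) * Complex.I := by push_cast; ring
    rw [h, h0, Real.cos_neg, Real.sin_neg]
  have h3 : coin α β k 0 1 = ⟨-(Real.cos k * Real.sin (α + β)),
      -(Real.sin k * Real.sin (α - β))⟩ := by
    simp only [coin, rot, phase, h1, h2, Matrix.mul_apply, Fin.sum_univ_two, Matrix.of_apply,
      Matrix.cons_val_zero, Matrix.cons_val_one, Matrix.cons_val', Matrix.cons_val_fin_one,
      Real.sin_add, Real.sin_sub]
    apply Complex.ext <;> simp only [Complex.add_re, Complex.add_im, Complex.mul_re,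
      Complex.mul_im, Complex.neg_re, Complex.neg_im, Complex.ofReal_re, Complex.ofReal_im,
      Complex.zero_re, Complex.zero_im] <;> ring
  rw [eta, h3]
  apply Complex.ext <;> simp

theorem eta_norm_le (α β k : ℝ) : ‖eta α β k‖ ≤ 1 := by
  have h : ‖eta α β k‖ ^ 2 ≤ 1 := by
    rw [← Complex.normSq_eq_norm_sq, eta_eq, Complex.normSq_mk]
    nlinarith [Real.sin_sq_add_cos_sq k, Real.sin_sq_le_one (α + β), Real.sin_sq_le_one (α - β),
      mul_le_mul_of_nonneg_left (Real.sin_sq_le_one (α + β)) (sq_nonneg (Real.cos k)),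
      mul_le_mul_of_nonneg_left (Real.sin_sq_le_one (α - β)) (sq_nonneg (Real.sin k))]
  exact (sq_le_one_iff₀ (norm_nonneg _)).mp h

/-- The Verblunsky parameters `(η(k), 0, η(k), 0, …)`. -/
def verblunsky (α β k : ℝ) (j : ℕ) : ℂ := if Even j then eta α β k else 0

theorem verblunsky_norm_le (α β k : ℝ) (j : ℕ) : ‖verblunsky α β k j‖ ≤ 1 := by
  unfold verblunsky
  split_ifs
  · exact eta_norm_le α β k
  · simp

/-- The operator `C_k`: the CMV matrix with Verblunsky parameters `(η(k), 0, η(k), 0, …)`. -/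
def cmvAt (α β k : ℝ) : HalfLine →L[ℂ] HalfLine :=
  cmv (verblunsky α β k) (verblunsky_norm_le α β k)

/-- The wave numbers `k ∈ [0, 2π)` with `|η(k)| < 1`, as the parameters of a CMV matrix must be. -/
def regularWaveNumbers (α β : ℝ) : Set ℝ := {k ∈ Ico 0 (2 * Real.pi) | ‖eta α β k‖ < 1}

/-- The dispersion relation for bulk states, a subset of `[0, 2π)²`. -/
def Bu (α β : ℝ) : Set (ℝ × ℝ) :=
  {p | p.1 ∈ regularWaveNumbers α β ∧ p.2 ∈ Ico 0 (2 * Real.pi) ∧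
    Complex.exp (Complex.I * p.2) ∈ continuousSpectrum (cmvAt α β p.1)}

/-- The dispersion relation for edge states, a subset of `[0, 2π)²`. -/
def Ed (α β : ℝ) : Set (ℝ × ℝ) :=
  {p | p.1 ∈ regularWaveNumbers α β ∧ p.2 ∈ Ico 0 (2 * Real.pi) ∧
    Complex.exp (Complex.I * p.2) ∈ pointSpectrum (cmvAt α β p.1)}

/-! ### The explicit functions -/

/-- `θ_c(k)`. -/
def thetaC (α β k : ℝ) : ℝ :=
  Real.arccos √(Real.cos (α - β) ^ 2
    - Real.sin (2 * α) * Real.sin (2 * β) * Real.cos k ^ 2)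

/-- The two closed bands of quasi-energies at wave number `k`. -/
def bands (α β k : ℝ) : Set ℝ :=
  Icc (thetaC α β k) (Real.pi - thetaC α β k) ∪
    Icc (Real.pi + thetaC α β k) (2 * Real.pi - thetaC α β k)

/-- `θ_0(k)`, an angle in `[-π/2, 3π/2]`. -/
def theta0 (α β k : ℝ) : ℝ :=
  if Real.cos k * Real.sin (α + β) ≤ 0 then
    Real.arcsin (-(Real.sin k * Real.sin (α - β)))
  else Real.pi - Real.arcsin (-(Real.sin k * Real.sin (α - β)))

/-- The representative in `[0, 2π)` of an angle. -/
def angleRep (θ : ℝ) : ℝ := toIcoMod Real.two_pi_pos 0 θ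

end

end AEWalk

namespace AEWalk

open Set Filter Topology

/-! Write `x_m = f (2m-1)` and `y_m = f (2m)`, with `x_0 = y_0 = f 0` at the boundary. Since the odd
Verblunsky parameters vanish, `C` acts through one 2×2 unitary matrix on the pairs `(x_m, y_{m+1})`,
where `ρ = √(1 - |η|²)`. So `C` is unitary, its spectrum lies on the unit circle, and for `|z| = 1`
injectivity of `C - z` forces dense range. Hence the spectrum is the disjoint union of point and
continuous spectrum.

Let `ρ > 0`. The equation `C f = z f` becomes a transfer recurrence for `(x_m, y_m)` of determinant
1 and trace `2 Re z / ρ`. If `|Re z| ≤ ρ`, its solutions grow at most linearly; damping one by `r ^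
m` and letting `r → 1` gives approximate eigenvectors, so `z` is in the spectrum
(`not_bijective_sub`). If `|Re z| > ρ`, the contributions of `η` to `Re ⟨f, C f⟩` cancel on the
hyperplane `f 0 = 0`, which bounds `C - z` below there; the range is then closed, and `C - z` is
onto unless `z` is an eigenvalue (`surjective_sub`).

For an eigenvector, the Wronskian of `x` and `y` is constant and tends to 0, so it vanishes. This
forces `x_m = y_m = l ^ m f 0` with `l = (Re z - Re η) / ρ`, together with `Im z = -Im η`; square
summability, `|l| < 1`, amounts to `Re z * Re η > 0` (`pointSpectrum_eq`). Such a `z` has `|Re z| >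
ρ`, so it lies off the bands.

If `ρ = 0`, `C` splits into multiplication by `star η` on the site 0 and infinitely many 2×2 blocks
of square `-1`, which gives the eigenvalues `±i` infinite multiplicity.

The angles enter through `cos θ_c = ρ`, and through `θ_0` being the angle with sine `-Im η` whose
cosine has the sign of `Re η`. -/

/-- The action of the CMV operator with Verblunsky parameters `(η, 0, η, 0, …)` in coordinates:
the pair of components `(2m - 1, 2m + 2)` is sent to the pair `(2m, 2m + 1)` by a unitary matrix.
The truncated subtraction `2 * 0 - 1 = 0` encodes the reflecting boundary. -/
structure IsAlternatingCMV (C : HalfLine →L[ℂ] HalfLine) (η : ℂ) (ρ : ℝ) : Prop where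
  nonneg : 0 ≤ ρ
  sq_add_sq : ρ ^ 2 + ‖η‖ ^ 2 = 1
  even (f : HalfLine) (m : ℕ) : C f (2 * m) = star η * f (2 * m - 1) + ρ * f (2 * m + 2)
  odd (f : HalfLine) (m : ℕ) : C f (2 * m + 1) = ρ * f (2 * m - 1) - η * f (2 * m + 2)

/-- With every odd parameter equal to 0, only two entries survive in each row. The convention
`a_{-1} = -1` makes column 0 stand in for the missing column `-1` in the first two rows. -/
theorem cmvAt_isAlternatingCMV (α β k : ℝ) :
    IsAlternatingCMV (cmvAt α β k) (eta α β k) √(1 - ‖eta α β k‖ ^ 2) where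
  nonneg := Real.sqrt_nonneg _
  sq_add_sq := by
    have := eta_norm_le α β k
    rw [Real.sq_sqrt (by nlinarith [norm_nonneg (eta α β k)])]
    ring
  even f m := by
    change cmvApply (verblunsky α β k) f (2 * m) = _
    unfold cmvApply
    rcases m with _ | m
    · simp [Finset.sum_range_succ, cmvMatrix, prevParam, cmvRho, verblunsky]
    · rw [Finset.sum_eq_add_of_mem (2 * (m + 1) - 1) (2 * (m + 1) + 2) (by simp; omega)
        (by simp) (by omega)]
      · have h1 : 2 * (m + 1) = 2 * m + 1 + 1 := by ring
        have h2 : ¬ Even (2 * m + 1 + 1 + 1) := by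
          rw [Nat.not_even_iff_odd]; exact ⟨m + 1, by ring⟩
        have h3 : Even (2 * m + 1 + 1) := ⟨m + 1, by ring⟩
        simp [cmvMatrix, prevRho, cmvRho, verblunsky, h1, h2, h3]
      · intro j _ hj
        have h2 : ¬ Even (2 * m + 1) := by
          rw [Nat.not_even_iff_odd]; exact ⟨m, by ring⟩
        have h3 : ¬ Even (2 * (m + 1) + 1) := by
          rw [Nat.not_even_iff_odd]; exact ⟨m + 1, by ring⟩
        have h4 : prevParam (verblunsky α β k) (2 * (m + 1)) = 0 := by
          change verblunsky α β k (2 * m + 1) = 0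
          simp [verblunsky]
        have h5 : verblunsky α β k (2 * (m + 1) + 1) = 0 := by
          simp [verblunsky]
        unfold cmvMatrix
        rw [h4, h5]
        have h6 : j + 1 ≠ 2 * (m + 1) := by omega
        have h7 : j ≠ 2 * (m + 1) + 2 := by omega
        simp [h6, h7]
  odd f m := by
    change cmvApply (verblunsky α β k) f (2 * m + 1) = _
    unfold cmvApply
    rcases m with _ | m
    · simp [Finset.sum_range_succ, cmvMatrix, prevParam, cmvRho, verblunsky]
      ring
    · rw [Finset.sum_eq_add_of_mem (2 * (m + 1) - 1) (2 * (m + 1) + 2) (by simp; omega)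
        (by simp) (by omega)]
      · have h1 : 2 * (m + 1) = 2 * m + 1 + 1 := by ring
        have h2 : ¬ Even (2 * m + 1 + 1 + 1) := by
          rw [Nat.not_even_iff_odd]; exact ⟨m + 1, by ring⟩
        have h3 : Even (2 * m + 1 + 1) := ⟨m + 1, by ring⟩
        simp [cmvMatrix, prevRho, cmvRho, verblunsky, h1, h2, h3]
        ring
      · intro j _ hj
        have h3 : ¬ Even (2 * (m + 1) + 1) := by
          rw [Nat.not_even_iff_odd]; exact ⟨m + 1, by ring⟩
        have h4 : prevParam (verblunsky α β k) (2 * (m + 1) + 1 - 1) = 0 := by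
          change verblunsky α β k (2 * m + 1) = 0
          simp [verblunsky]
        have h5 : verblunsky α β k (2 * (m + 1) + 1) = 0 := by
          simp [verblunsky]
        unfold cmvMatrix
        rw [h4, h5]
        have h6 : j + 2 ≠ 2 * (m + 1) + 1 := by omega
        have h7 : j ≠ 2 * (m + 1) + 1 + 1 := by omega
        simp [h3, h6, h7]

/-! ### Sums over the half line -/

theorem hasSum_of_even_odd_pairs {h : ℕ → ℝ} {s : ℝ} (hs : HasSum h s) :
    HasSum (fun m => h (2 * m) + h (2 * m + 1)) s := by
  have h0 : Summable fun m => h (2 * m) :=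
    hs.summable.comp_injective (i := fun m => 2 * m) fun a b hab => by simpa using hab
  have h1 : Summable fun m => h (2 * m + 1) :=
    hs.summable.comp_injective (i := fun m => 2 * m + 1) fun a b hab => by simpa using hab
  have := h0.hasSum.add h1.hasSum
  rwa [(h0.hasSum.even_add_odd h1.hasSum).unique hs] at this

/-- The pairs `(2m-1, 2m+2)` partition `ℕ`: truncation sends `m = 0` to the index 0, and the later
first members are the odd numbers. -/
theorem hasSum_of_boundary_pairs {h : ℕ → ℝ} {s : ℝ} (hs : HasSum h s) :
    HasSum (fun m => h (2 * m - 1) + h (2 * m + 2)) s := by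
  have h0 : Summable fun m => h (2 * m - 1) := by
    rw [← summable_nat_add_iff 1]
    exact hs.summable.comp_injective (i := fun m => 2 * (m + 1) - 1) fun a b hab => by
      simp only at hab; omega
  have h1 : Summable fun m => h (2 * m + 2) :=
    hs.summable.comp_injective (i := fun m => 2 * m + 2) fun a b hab => by simpa using hab
  have h2 := (hasSum_nat_add_iff' 1).2 hs
  have h3 := (hasSum_nat_add_iff' 1).2 h0.hasSum
  have h4 := h3.even_add_odd (f := fun n => h (n + 1)) h1.hasSum
  have h5 := h4.unique h2
  simp only [Finset.sum_range_one, mul_zero, Nat.zero_sub] at h5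
  have := h0.hasSum.add h1.hasSum
  rwa [show ∑' m, h (2 * m - 1) + ∑' m, h (2 * m + 2) = s by linarith] at this

theorem hasSum_norm_sq (f : HalfLine) : HasSum (fun i => ‖f i‖ ^ 2) (‖f‖ ^ 2) := by
  simpa using lp.hasSum_norm (p := 2) (by norm_num) f

theorem memlp_two_of_summable {f : ℕ → ℂ} (h : Summable fun i => ‖f i‖ ^ 2) :
    Memℓp f 2 := by
  rw [memℓp_gen_iff (by norm_num)]
  simpa using h

theorem tendsto_apply_zero (f : HalfLine) : Tendsto (fun i => f i) atTop (𝓝 0) := by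
  have h := (hasSum_norm_sq f).summable.tendsto_atTop_zero
  rw [tendsto_zero_iff_norm_tendsto_zero]
  have := (Real.continuous_sqrt.tendsto 0).comp h
  simpa [Function.comp_def, Real.sqrt_sq (norm_nonneg _)] using this

/-- This is unitarity of the matrix with rows `(star η, ρ)` and `(ρ, -η)`. -/
theorem norm_sq_coin_add {η : ℂ} {ρ : ℝ} (h : ρ ^ 2 + ‖η‖ ^ 2 = 1) (x y : ℂ) :
    ‖star η * x + ρ * y‖ ^ 2 + ‖ρ * x - η * y‖ ^ 2 = ‖x‖ ^ 2 + ‖y‖ ^ 2 := by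
  rw [← Complex.normSq_eq_norm_sq] at h
  simp only [← Complex.normSq_eq_norm_sq]
  rw [Complex.normSq_apply] at h
  simp only [Complex.normSq_apply, Complex.add_re, Complex.add_im, Complex.sub_re, Complex.sub_im,
    Complex.mul_re, Complex.mul_im, Complex.star_def, Complex.conj_re, Complex.conj_im,
    Complex.ofReal_re, Complex.ofReal_im]
  linear_combination (x.re ^ 2 + x.im ^ 2 + y.re ^ 2 + y.im ^ 2) * h

/-! ### Unitarity and density of the range -/

namespace IsAlternatingCMV

variable {C : HalfLine →L[ℂ] HalfLine} {η : ℂ} {ρ : ℝ}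

theorem eta_mul_star (hC : IsAlternatingCMV C η ρ) : η * star η = 1 - (ρ : ℂ) ^ 2 := by
  have h := hC.sq_add_sq
  rw [Complex.star_def, Complex.mul_conj, Complex.normSq_eq_norm_sq]
  have : ‖η‖ ^ 2 = 1 - ρ ^ 2 := by linarith
  rw [this]; push_cast; ring

theorem norm_map (hC : IsAlternatingCMV C η ρ) (f : HalfLine) : ‖C f‖ = ‖f‖ := by
  have h1 := hasSum_of_even_odd_pairs (hasSum_norm_sq (C f))
  have h2 := hasSum_of_boundary_pairs (hasSum_norm_sq f)
  simp only [hC.even, hC.odd, norm_sq_coin_add hC.sq_add_sq] at h1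
  exact (sq_eq_sq₀ (norm_nonneg _) (norm_nonneg _)).1 (h1.unique h2)

theorem surjective (hC : IsAlternatingCMV C η ρ) : Function.Surjective C := by
  intro g
  -- The preimage comes from applying the adjoint 2×2 matrix to each pair `(g (2m), g (2m+1))`.
  let F : ℕ → ℂ := fun i =>
    if i = 0 then η * g 0 + ρ * g 1
    else if Even i then ρ * g (i - 2) - star η * g (i - 1)
    else η * g (i + 1) + ρ * g (i + 2)
  have Fx : ∀ m, F (2 * m - 1) = η * g (2 * m) + ρ * g (2 * m + 1) := by
    rintro (_ | m)
    · simp [F]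
    · have h2 : ¬ Even (2 * m + 1) := by rw [Nat.not_even_iff_odd]; exact ⟨m, by ring⟩
      simp [F, h2, mul_add]
  have Fy : ∀ m, F (2 * m + 2) = ρ * g (2 * m) - star η * g (2 * m + 1) := by
    intro m
    have h2 : Even (2 * m + 2) := ⟨m + 1, by ring⟩
    simp [F, h2]
  have hF : Summable fun i => ‖F i‖ ^ 2 := by
    have h1 := (hasSum_of_even_odd_pairs (hasSum_norm_sq g)).summable
    have h2 : ∀ m, ‖F (2 * m - 1)‖ ^ 2 + ‖F (2 * m + 2)‖ ^ 2
        = ‖g (2 * m)‖ ^ 2 + ‖g (2 * m + 1)‖ ^ 2 := by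
      intro m
      have h := norm_sq_coin_add (η := star η) (by simpa using hC.sq_add_sq)
        (g (2 * m)) (g (2 * m + 1))
      rw [star_star] at h
      rw [Fx, Fy, h]
    simp only [← h2] at h1
    have hx : Summable fun m => ‖F (2 * m - 1)‖ ^ 2 :=
      h1.of_nonneg_of_le (fun _ => sq_nonneg _) fun m => le_add_of_nonneg_right (sq_nonneg _)
    have hy : Summable fun m => ‖F (2 * m + 2)‖ ^ 2 :=
      h1.of_nonneg_of_le (fun _ => sq_nonneg _) fun m => le_add_of_nonneg_left (sq_nonneg _)
    rw [← summable_nat_add_iff 1]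
    have hx' := (summable_nat_add_iff 1).2 hx
    exact (hx'.hasSum.even_add_odd (f := fun n => ‖F (n + 1)‖ ^ 2) hy.hasSum).summable
  refine ⟨⟨F, memlp_two_of_summable hF⟩, ?_⟩
  have key := hC.eta_mul_star
  ext i
  obtain ⟨m, rfl | rfl⟩ := Nat.even_or_odd' i
  · rw [hC.even]
    change star η * F (2 * m - 1) + ρ * F (2 * m + 2) = _
    rw [Fx, Fy]
    linear_combination g (2 * m) * key
  · rw [hC.odd]
    change ρ * F (2 * m - 1) - η * F (2 * m + 2) = _
    rw [Fx, Fy]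
    linear_combination g (2 * m + 1) * key

theorem mem_unitary (hC : IsAlternatingCMV C η ρ) : C ∈ unitary (HalfLine →L[ℂ] HalfLine) := by
  have hu : IsUnit C := ContinuousLinearMap.isUnit_iff_bijective.2
    ⟨(AddMonoidHomClass.isometry_of_norm C hC.norm_map).injective, hC.surjective⟩
  refine hu.mem_unitary_iff_star_mul_self.2 ?_
  exact (ContinuousLinearMap.norm_map_iff_adjoint_comp_self C).1 hC.norm_map

theorem norm_eq_one_of_mem_spectrum (hC : IsAlternatingCMV C η ρ) {z : ℂ}
    (hz : z ∈ spectrum ℂ C) : ‖z‖ = 1 := by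
  simpa using spectrum.subset_circle_of_unitary hC.mem_unitary hz

/-- A vector orthogonal to the range satisfies `C* g = star z • g`; by unitarity and `|z| = 1` this
says `C g = z • g`, so injectivity gives `g = 0`. -/
theorem denseRange_sub (hC : IsAlternatingCMV C η ρ) {z : ℂ} (hz : ‖z‖ = 1)
    (hinj : Function.Injective (C - z • ContinuousLinearMap.id ℂ HalfLine)) :
    DenseRange (C - z • ContinuousLinearMap.id ℂ HalfLine) := by
  have key : (C - z • ContinuousLinearMap.id ℂ HalfLine).range.topologicalClosure = ⊤ := by
    rw [Submodule.topologicalClosure_eq_top_iff, Submodule.eq_bot_iff]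
    intro g hg
    have h1 : ∀ f, inner ℂ (C f) g = inner ℂ (z • f) g := by
      intro f
      have := (Submodule.mem_orthogonal _ _).1 hg _ ⟨f, rfl⟩
      change inner ℂ (C f - z • f) g = 0 at this
      rwa [inner_sub_left, sub_eq_zero] at this
    have h2 : inner ℂ (C g) g = starRingEnd ℂ z * inner ℂ g g := by
      rw [h1, inner_smul_left]
    apply hinj
    rw [map_zero]
    have h3 : ∀ f, inner ℂ (C f) (C g) = inner ℂ f g := fun f =>
      ContinuousLinearMap.inner_map_map_of_mem_unitary hC.mem_unitary f g
    have hzz : starRingEnd ℂ z * z = 1 := by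
      rw [mul_comm, Complex.mul_conj, Complex.normSq_eq_norm_sq, hz]; simp
    have h4 : ∀ f, inner ℂ (C f) (C g - z • g) = (0 : ℂ) := by
      intro f
      rw [inner_sub_right, h3, inner_smul_right, h1, inner_smul_left]
      linear_combination - inner ℂ f g * hzz
    obtain ⟨f, hf⟩ := hC.surjective (C g - z • g)
    have h5 := h4 f
    rw [hf, inner_self_eq_zero] at h5
    simpa using h5
  exact (Submodule.dense_iff_topologicalClosure_eq_top).2 key

end IsAlternatingCMV

/-! ### Spectra in terms of injectivity and bijectivity of `T - z` -/

theorem mem_pointSpectrum_iff {T : HalfLine →L[ℂ] HalfLine} {z : ℂ} :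
    z ∈ pointSpectrum T ↔ ∃ f : HalfLine, f ≠ 0 ∧ T f = z • f := by
  constructor
  · intro h
    obtain ⟨f, hf⟩ := Module.End.HasEigenvalue.exists_hasEigenvector h
    exact ⟨f, hf.2, hf.apply_eq_smul⟩
  · rintro ⟨f, hf, h⟩
    exact Module.End.hasEigenvalue_of_hasEigenvector ⟨Module.End.mem_eigenspace_iff.2 h, hf⟩

theorem notMem_pointSpectrum_iff {T : HalfLine →L[ℂ] HalfLine} {z : ℂ} :
    z ∉ pointSpectrum T ↔ Function.Injective (T - z • ContinuousLinearMap.id ℂ HalfLine) := by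
  rw [mem_pointSpectrum_iff, injective_iff_map_eq_zero]
  push Not
  refine ⟨fun h f hf => ?_, fun h f hf hT => hf (h f ?_)⟩
  · by_contra hne
    exact h f hne (sub_eq_zero.1 hf)
  · exact sub_eq_zero.2 hT

theorem mem_spectrum_iff_not_bijective {T : HalfLine →L[ℂ] HalfLine} {z : ℂ} :
    z ∈ spectrum ℂ T ↔
      ¬ Function.Bijective (T - z • ContinuousLinearMap.id ℂ HalfLine) := by
  rw [← ContinuousLinearMap.isUnit_iff_bijective, spectrum.mem_iff, not_iff_not,
    ← IsUnit.neg_iff, neg_sub]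
  rfl

theorem continuousSpectrum_subset_spectrum (T : HalfLine →L[ℂ] HalfLine) :
    continuousSpectrum T ⊆ spectrum ℂ T := fun _ hz =>
  mem_spectrum_iff_not_bijective.2 fun h => hz.2.2 h.2

theorem pointSpectrum_subset_spectrum (T : HalfLine →L[ℂ] HalfLine) :
    pointSpectrum T ⊆ spectrum ℂ T := fun _ hz =>
  mem_spectrum_iff_not_bijective.2 fun h => notMem_pointSpectrum_iff.2 h.1 hz

/-- An operator bounded below on a hyperplane has closed range. -/
theorem isClosed_range_of_bounded_below_on_ker {E F : Type*} [NormedAddCommGroup E]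
    [NormedSpace ℂ E] [CompleteSpace E] [NormedAddCommGroup F] [NormedSpace ℂ F]
    (T : E →L[ℂ] F) (φ : E →L[ℂ] ℂ) {c : ℝ} (hc : 0 < c)
    (h : ∀ f, φ f = 0 → c * ‖f‖ ≤ ‖T f‖) : IsClosed (Set.range T) := by
  let s : Submodule ℂ E := φ.ker
  have hs : IsClosed (s : Set E) := φ.isClosed_ker
  have : CompleteSpace s := hs.completeSpace_coe
  have hsc : s.CoFG := Submodule.range_fg_iff_ker_cofg.1 (IsNoetherian.noetherian _)
  refine LinearMap.isClosed_range_of_isClosed_map_of_finiteDimensional_quotient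
    (f := (T : E →ₗ[ℂ] F)) (s := s) ?_
  have h1 : AntilipschitzWith (Real.toNNReal c⁻¹) (T.comp s.subtypeL) := by
    refine AddMonoidHomClass.antilipschitz_of_bound _ fun x => ?_
    rw [Real.coe_toNNReal _ (by positivity)]
    have := h x x.2
    rw [inv_mul_eq_div, le_div_iff₀ hc, mul_comm]
    exact this
  have h2 := h1.isClosed_range (T.comp s.subtypeL).uniformContinuous
  convert h2 using 1
  ext y
  simp

/-- Solutions of `u (n + 2) = t u (n + 1) - u n` with `|t| ≤ 2` grow at most linearly. -/
theorem exists_linear_growth_bound {t : ℝ} (ht : |t| ≤ 2) {u : ℕ → ℂ}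
    (hu : ∀ n, u (n + 2) = t * u (n + 1) - u n) :
    ∃ A : ℝ, ∀ n : ℕ, ‖u n‖ ≤ A * (n + 1) := by
  -- For `|t| ≤ 2` both characteristic roots `r`, `s` are unimodular. The difference `u (n+1) - r u
  -- n` is multiplied by `s` at each step, so its norm is constant and `‖u n‖` grows by at most that
  -- constant.
  have ht' := abs_le.1 ht
  obtain ⟨r, s, hr, hs, hrs, hadd⟩ : ∃ r s : ℂ, ‖r‖ = 1 ∧ ‖s‖ = 1 ∧ r * s = 1 ∧ r + s = t := by
    set φ := Real.arccos (t / 2)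
    have hcos : 2 * Real.cos φ = t := by
      rw [Real.cos_arccos (by linarith) (by linarith)]; ring
    refine ⟨Complex.exp (φ * Complex.I), Complex.exp ((-φ : ℝ) * Complex.I),
      Complex.norm_exp_ofReal_mul_I _, Complex.norm_exp_ofReal_mul_I _, ?_, ?_⟩
    · rw [← Complex.exp_add]; simp
    · rw [← hcos]; push_cast; rw [Complex.cos]; ring_nf
  have hw : ∀ n, ‖u (n + 1) - r * u n‖ = ‖u 1 - r * u 0‖ := by
    intro n
    induction n with
    | zero => rfl
    | succ n ih =>
      have : u (n + 1 + 1) - r * u (n + 1) = s * (u (n + 1) - r * u n) := by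
        rw [hu, ← hadd]; linear_combination u n * hrs
      rw [this, norm_mul, hs, one_mul, ih]
  refine ⟨‖u 0‖ + ‖u 1 - r * u 0‖, fun n => ?_⟩
  induction n with
  | zero => simp
  | succ n ih =>
    have h1 : ‖u (n + 1)‖ ≤ ‖u (n + 1) - r * u n‖ + ‖r * u n‖ := by
      simpa using norm_add_le (u (n + 1) - r * u n) (r * u n)
    rw [hw, norm_mul, hr, one_mul] at h1
    push_cast
    nlinarith [norm_nonneg (u 0)]

theorem abs_re_star_mul_le (a b : ℂ) : |(star a * b).re| ≤ (‖a‖ ^ 2 + ‖b‖ ^ 2) / 2 := by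
  refine (Complex.abs_re_le_norm _).trans ?_
  rw [norm_mul, norm_star]
  nlinarith [sq_nonneg (‖a‖ - ‖b‖)]

/-! ### Off the bands: the numerical range estimate -/

namespace IsAlternatingCMV

variable {C : HalfLine →L[ℂ] HalfLine} {η : ℂ} {ρ : ℝ}

theorem spectrum_eq (hC : IsAlternatingCMV C η ρ) :
    spectrum ℂ C = continuousSpectrum C ∪ pointSpectrum C := by
  refine Set.Subset.antisymm (fun z hz => ?_)
    (union_subset (continuousSpectrum_subset_spectrum C) (pointSpectrum_subset_spectrum C))
  by_cases hp : z ∈ pointSpectrum C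
  · exact Or.inr hp
  · have hinj := notMem_pointSpectrum_iff.1 hp
    refine Or.inl ⟨hinj, hC.denseRange_sub (hC.norm_eq_one_of_mem_spectrum hz) hinj, fun hs => ?_⟩
    exact mem_spectrum_iff_not_bijective.1 hz ⟨hinj, hs⟩

/-- On sequences vanishing at the boundary the numerical range of `C` lies in `|Re w| ≤ ρ`. -/
theorem abs_re_inner_le (hC : IsAlternatingCMV C η ρ) (f : HalfLine) (hf : f 0 = 0) :
    |(inner ℂ f (C f)).re| ≤ ρ * ‖f‖ ^ 2 := by
  have hsum : HasSum (fun i => (star (f i) * C f i).re) (inner ℂ f (C f)).re := by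
    have := Complex.hasSum_re (lp.hasSum_inner (𝕜 := ℂ) f (C f))
    simpa [mul_comm] using this
  have hsum1 := hasSum_of_even_odd_pairs ((hasSum_nat_add_iff' 1).2 hsum)
  simp only [Finset.sum_range_one, hf, star_zero, zero_mul, Complex.zero_re, sub_zero] at hsum1
  have hx := hasSum_of_boundary_pairs (hasSum_norm_sq f)
  have hy := hasSum_of_even_odd_pairs ((hasSum_nat_add_iff' 1).2 (hasSum_norm_sq f))
  simp only [Finset.sum_range_one, hf, norm_zero, ne_eq, OfNat.ofNat_ne_zero, not_false_eq_true,
    zero_pow, sub_zero] at hy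
  have hxs : Summable fun m => ‖f (2 * m - 1)‖ ^ 2 :=
    hx.summable.of_nonneg_of_le (fun _ => sq_nonneg _)
      fun m => le_add_of_nonneg_right (sq_nonneg _)
  have hys : Summable fun m => ‖f (2 * m + 2)‖ ^ 2 :=
    hx.summable.of_nonneg_of_le (fun _ => sq_nonneg _) fun m => le_add_of_nonneg_left (sq_nonneg _)
  have hys' : Summable fun m => ‖f (2 * m + 4)‖ ^ 2 := (summable_nat_add_iff 1).2 hys
  have hle : ∑' m, (‖f (2 * m - 1)‖ ^ 2 + ‖f (2 * m + 4)‖ ^ 2) ≤ ‖f‖ ^ 2 := by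
    rw [← hx.tsum_eq, hxs.tsum_add hys', hxs.tsum_add hys]
    rw [hys.tsum_eq_zero_add]
    have : 0 ≤ ‖f (2 * 0 + 2)‖ ^ 2 := sq_nonneg _
    have h4 : ∑' m, ‖f (2 * m + 4)‖ ^ 2 = ∑' m, ‖f (2 * (m + 1) + 2)‖ ^ 2 := rfl
    linarith
  let B : ℕ → ℝ := fun m => ρ / 2 * ((‖f (2 * m + 1)‖ ^ 2 + ‖f (2 * m + 2)‖ ^ 2) +
    (‖f (2 * m - 1)‖ ^ 2 + ‖f (2 * m + 4)‖ ^ 2))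
  have hB := (hy.add (hxs.add hys').hasSum).mul_left (ρ / 2)
  have hterm : ∀ m, |(star (f (2 * m + 1)) * C f (2 * m + 1)).re +
      (star (f (2 * m + 1 + 1)) * C f (2 * m + 1 + 1)).re| ≤ B m := by
    intro m
    have h1 := hC.odd f m
    have h2 := hC.even f (m + 1)
    have e1 : 2 * (m + 1) = 2 * m + 1 + 1 := by ring
    have e2 : 2 * m + 1 + 1 - 1 = 2 * m + 1 := by omega
    have e3 : 2 * m + 2 = 2 * m + 1 + 1 := by ring
    have e4 : 2 * m + 1 + 1 + 2 = 2 * m + 4 := by ring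
    rw [e1, e2, e4] at h2
    rw [h1, h2, e3]
    -- The two terms containing `η` are conjugate with opposite signs, so they cancel in the real
    -- part. This needs sites `2m+1` and `2m+2` together, which is why the site 0, having no
    -- partner, must carry `f 0 = 0`.
    have h3 : (star (f (2 * m + 1)) * (ρ * f (2 * m - 1) - η * f (2 * m + 1 + 1))).re +
        (star (f (2 * m + 1 + 1)) * (star η * f (2 * m + 1) + ρ * f (2 * m + 4))).re
        = ρ * ((star (f (2 * m + 1)) * f (2 * m - 1)).re +
          (star (f (2 * m + 1 + 1)) * f (2 * m + 4)).re) := by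
      simp only [Complex.add_re, Complex.sub_re, Complex.add_im, Complex.sub_im,
        Complex.mul_re, Complex.mul_im, Complex.star_def, Complex.conj_re, Complex.conj_im,
        Complex.ofReal_re, Complex.ofReal_im]
      ring
    rw [h3, abs_mul, abs_of_nonneg hC.nonneg]
    have h4 := abs_re_star_mul_le (f (2 * m + 1)) (f (2 * m - 1))
    have h5 := abs_re_star_mul_le (f (2 * m + 1 + 1)) (f (2 * m + 4))
    have h6 := (abs_add_le _ _).trans (add_le_add h4 h5)
    refine (mul_le_mul_of_nonneg_left h6 hC.nonneg).trans (le_of_eq ?_)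
    simp only [B, e3]
    ring
  have hfin : |(inner ℂ f (C f)).re| ≤ ρ / 2 * (‖f‖ ^ 2 +
      ∑' m, (‖f (2 * m - 1)‖ ^ 2 + ‖f (2 * m + 4)‖ ^ 2)) := by
    rw [abs_le]
    constructor
    · exact hasSum_le (fun m => (abs_le.1 (hterm m)).1) hB.neg hsum1
    · exact hasSum_le (fun m => (abs_le.1 (hterm m)).2) hsum1 hB
  refine hfin.trans ?_
  nlinarith [hC.nonneg]

/-- The numerical range estimate bounds `C - z` below by `|Re z| - ρ` on `f 0 = 0`. This hyperplane
has finite codimension, so the range is closed; it is dense as well. -/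
theorem surjective_sub (hC : IsAlternatingCMV C η ρ) {z : ℂ} (hz : ‖z‖ = 1) (hre : ρ < |z.re|)
    (hp : z ∉ pointSpectrum C) :
    Function.Surjective (C - z • ContinuousLinearMap.id ℂ HalfLine) := by
  have hinj := notMem_pointSpectrum_iff.1 hp
  have hdense := hC.denseRange_sub hz hinj
  have hclosed := isClosed_range_of_bounded_below_on_ker
    (C - z • ContinuousLinearMap.id ℂ HalfLine) (lp.evalCLM ℂ (fun _ : ℕ => ℂ) 2 0)
    (sub_pos.2 hre) fun f hf => ?_
  · rw [← Set.range_eq_univ, ← hclosed.closure_eq, hdense.closure_range]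
  · have hf0 : f 0 = 0 := hf
    have h1 := hC.abs_re_inner_le f hf0
    have h2 : (inner ℂ f ((C - z • ContinuousLinearMap.id ℂ HalfLine) f)).re
        = (inner ℂ f (C f)).re - z.re * ‖f‖ ^ 2 := by
      change (inner ℂ f (C f - z • f)).re = _
      rw [inner_sub_right, inner_smul_right, inner_self_eq_norm_sq_to_K, Complex.sub_re,
        Complex.mul_re]
      simp [← Complex.ofReal_pow]
    have h3 : |(inner ℂ f ((C - z • ContinuousLinearMap.id ℂ HalfLine) f)).re| ≤
        ‖f‖ * ‖(C - z • ContinuousLinearMap.id ℂ HalfLine) f‖ :=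
      (Complex.abs_re_le_norm _).trans (norm_inner_le_norm _ _)
    rw [h2] at h3
    have h4 : |z.re| * ‖f‖ ^ 2 ≤ ρ * ‖f‖ ^ 2 +
        ‖f‖ * ‖(C - z • ContinuousLinearMap.id ℂ HalfLine) f‖ := by
      have h5 : |z.re * ‖f‖ ^ 2| = |z.re| * ‖f‖ ^ 2 := by rw [abs_mul, abs_sq]
      have h6 := abs_sub_abs_le_abs_sub (z.re * ‖f‖ ^ 2) (inner ℂ f (C f)).re
      rw [abs_sub_comm] at h6
      linarith
    rcases (norm_nonneg f).eq_or_lt with h0 | h0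
    · rw [← h0, mul_zero]; exact norm_nonneg _
    · refine le_of_mul_le_mul_left ?_ h0
      nlinarith

end IsAlternatingCMV

/-! ### On the bands: transfer recurrence and approximate eigenvectors -/

theorem norm_sq_eq_re_sq_add_im_sq (z : ℂ) : ‖z‖ ^ 2 = z.re ^ 2 + z.im ^ 2 := by
  rw [← Complex.normSq_eq_norm_sq, Complex.normSq_apply]; ring

theorem mul_star_eq_one_of_norm {z : ℂ} (hz : ‖z‖ = 1) : z * star z = 1 := by
  rw [Complex.star_def, Complex.mul_conj, Complex.normSq_eq_norm_sq, hz]; simp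

namespace IsAlternatingCMV

variable {C : HalfLine →L[ℂ] HalfLine} {η : ℂ} {ρ : ℝ}

theorem pointSpectrum_norm_eq_one (hC : IsAlternatingCMV C η ρ) {z : ℂ}
    (hz : z ∈ pointSpectrum C) : ‖z‖ = 1 :=
  hC.norm_eq_one_of_mem_spectrum (pointSpectrum_subset_spectrum C hz)

end IsAlternatingCMV

/-- The formal solution `(x_m, y_m)` of the eigenvalue equation, started at `(1, 1)`. -/
noncomputable def formalSolution (η : ℂ) (ρ : ℝ) (z : ℂ) : ℕ → ℂ × ℂ
  | 0 => (1, 1)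
  | m + 1 =>
    ((star z * (formalSolution η ρ z m).1 - η * (formalSolution η ρ z m).2) / ρ,
      (z * (formalSolution η ρ z m).2 - star η * (formalSolution η ρ z m).1) / ρ)

theorem summable_linear_growth_damped {u : ℕ → ℂ} {A r : ℝ} (hu : ∀ n : ℕ, ‖u n‖ ≤ A * (n + 1))
    (hr0 : 0 ≤ r) (hr1 : r < 1) : Summable fun m => ‖(r : ℂ) ^ m * u m‖ ^ 2 := by
  have hr2 : ‖r ^ 2‖ < 1 := by
    rw [Real.norm_of_nonneg (by positivity)]; nlinarith
  have h := (((summable_pow_mul_geometric_of_norm_lt_one 2 hr2).add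
    ((summable_pow_mul_geometric_of_norm_lt_one 1 hr2).mul_left 2)).add
    (summable_pow_mul_geometric_of_norm_lt_one 0 hr2)).mul_left (A ^ 2)
  refine h.of_nonneg_of_le (fun _ => sq_nonneg _) fun m => ?_
  have h1 : ‖(r : ℂ) ^ m * u m‖ = r ^ m * ‖u m‖ := by
    rw [norm_mul, norm_pow, Complex.norm_real, Real.norm_of_nonneg hr0]
  have h2 : ‖u m‖ ^ 2 ≤ (A * (m + 1)) ^ 2 := pow_le_pow_left₀ (norm_nonneg _) (hu m) 2
  rw [h1, mul_pow]
  calc (r ^ m) ^ 2 * ‖u m‖ ^ 2 ≤ (r ^ m) ^ 2 * (A * (m + 1)) ^ 2 := by gcongr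
    _ = _ := by ring

namespace IsAlternatingCMV

variable {C : HalfLine →L[ℂ] HalfLine} {η : ℂ} {ρ : ℝ}

/-- Cayley–Hamilton for the transfer matrix, whose trace is `2 Re z / ρ` and whose determinant is
`(|z|² - |η|²) / ρ² = 1`. -/
theorem formalSolution_recurrence (hC : IsAlternatingCMV C η ρ) (hρ : 0 < ρ) {z : ℂ}
    (hz : ‖z‖ = 1) (m : ℕ) :
    (formalSolution η ρ z (m + 2)).1 = ((2 * z.re / ρ : ℝ) : ℂ) * (formalSolution η ρ z (m + 1)).1
        - (formalSolution η ρ z m).1 ∧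
      (formalSolution η ρ z (m + 2)).2 = ((2 * z.re / ρ : ℝ) : ℂ) * (formalSolution η ρ z (m + 1)).2
        - (formalSolution η ρ z m).2 := by
  have hρ' : (ρ : ℂ) ≠ 0 := by exact_mod_cast hρ.ne'
  have hzz := mul_star_eq_one_of_norm hz
  have key := hC.eta_mul_star
  have hre : ((2 * z.re : ℝ) : ℂ) = z + star z := by
    rw [Complex.star_def, Complex.add_conj]
  constructor
  · simp only [formalSolution]
    rw [Complex.ofReal_div, hre]
    field_simp
    linear_combination (formalSolution η ρ z m).1 * (key - hzz)
  · simp only [formalSolution]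
    rw [Complex.ofReal_div, hre]
    field_simp
    linear_combination (formalSolution η ρ z m).2 * (key - hzz)

theorem exists_approximate_eigenvector (hC : IsAlternatingCMV C η ρ) (hρ : 0 < ρ) {z : ℂ}
    (hz : ‖z‖ = 1) (hre : |z.re| ≤ ρ) {r : ℝ} (hr0 : 0 < r) (hr1 : r < 1) :
    ∃ f : HalfLine, f ≠ 0 ∧
      ‖(C - z • ContinuousLinearMap.id ℂ HalfLine) f‖ ≤ (1 - r) / r * ‖f‖ := by
  have hρ' : (ρ : ℂ) ≠ 0 := by exact_mod_cast hρ.ne'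
  have hr' : (r : ℂ) ≠ 0 := by exact_mod_cast hr0.ne'
  have hzz := mul_star_eq_one_of_norm hz
  have key := hC.eta_mul_star
  have ht : |2 * z.re / ρ| ≤ 2 := by
    rw [abs_div, abs_mul, abs_of_pos hρ, abs_two, div_le_iff₀ hρ]; linarith
  set v := formalSolution η ρ z with hv
  obtain ⟨A, hA⟩ := exists_linear_growth_bound (u := fun m => (v m).1) ht fun m =>
    (hC.formalSolution_recurrence hρ hz m).1
  obtain ⟨B, hB⟩ := exists_linear_growth_bound (u := fun m => (v m).2) ht fun m =>
    (hC.formalSolution_recurrence hρ hz m).2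
  -- The site `2m` carries the damped `y_m` and the site `2m-1` the damped `x_m`. At the site 0 they
  -- agree because the formal solution starts at `(1, 1)`.
  let F : ℕ → ℂ := fun i => if Even i then (r : ℂ) ^ (i / 2) * (v (i / 2)).2
    else (r : ℂ) ^ ((i + 1) / 2) * (v ((i + 1) / 2)).1
  have Fx : ∀ m, F (2 * m - 1) = (r : ℂ) ^ m * (v m).1 := by
    rintro (_ | m)
    · simp [F, hv, formalSolution]
    · have h1 : 2 * (m + 1) - 1 = 2 * m + 1 := by omega
      have h2 : (2 * m + 1 + 1) / 2 = m + 1 := by omega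
      simp [F, h1, h2]
  have Fy : ∀ m, F (2 * m) = (r : ℂ) ^ m * (v m).2 := by
    intro m
    simp [F]
  have hF : Summable fun i => ‖F i‖ ^ 2 := by
    have hx := summable_linear_growth_damped hA hr0.le hr1
    have hy := summable_linear_growth_damped hB hr0.le hr1
    have hx' : Summable fun m => ‖F (2 * m + 1)‖ ^ 2 := by
      refine ((summable_nat_add_iff 1).2 hx).congr fun m => ?_
      rw [← Fx]; rfl
    have hy' : Summable fun m => ‖F (2 * m)‖ ^ 2 := hy.congr fun m => by rw [← Fy]
    exact (hy'.hasSum.even_add_odd (f := fun n => ‖F n‖ ^ 2) hx'.hasSum).summable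
  let f : HalfLine := ⟨F, memlp_two_of_summable hF⟩
  have hfF : ∀ i, f i = F i := fun _ => rfl
  have vx : ∀ m, ρ * (v (m + 1)).1 = star z * (v m).1 - η * (v m).2 := fun m => by
    rw [hv]; simp only [formalSolution]; field_simp
  have vy : ∀ m, ρ * (v (m + 1)).2 = z * (v m).2 - star η * (v m).1 := fun m => by
    rw [hv]; simp only [formalSolution]; field_simp
  set g := (C - z • ContinuousLinearMap.id ℂ HalfLine) f with hg
  have hgC : ∀ i, g i = C f i - z * f i := fun _ => rfl
  -- The undamped sequence solves the equation exactly, so only the mismatch between `r ^ m` and `r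
  -- ^ (m+1)` remains, proportional to `1 - r`.
  have ge : ∀ m, g (2 * m) = -((((1 - r) / r * ρ : ℝ) : ℂ) * f (2 * m + 2)) := by
    intro m
    rw [hgC, hC.even]
    have h2 := Fy (m + 1)
    rw [mul_add, mul_one] at h2
    rw [hfF, hfF, hfF, Fx, Fy, h2]
    push_cast
    field_simp
    have := vy m
    linear_combination (r : ℂ) ^ (m + 1) * this
  have go : ∀ m, g (2 * m + 1) = (((1 - r) * ρ : ℝ) : ℂ) * f (2 * m - 1) := by
    intro m
    rw [hgC, hC.odd]
    have h1 : F (2 * m + 1) = _ := Fx (m + 1)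
    have h2 := Fy (m + 1)
    rw [mul_add, mul_one] at h2
    rw [hfF, hfF, hfF, Fx, h1, h2]
    push_cast
    refine mul_left_cancel₀ hρ' ?_
    have hx := vx m
    have hy := vy m
    linear_combination (-z * (r : ℂ) ^ (m + 1)) * hx + (-η * (r : ℂ) ^ (m + 1)) * hy
      + (r : ℂ) ^ (m + 1) * (v m).1 * (key - hzz)
  have hρ1 : ρ ≤ 1 := by
    have := hC.sq_add_sq
    nlinarith [sq_nonneg ‖η‖]
  refine ⟨f, fun h0 => ?_, ?_⟩
  · have h1 : f 0 = 0 := by rw [h0]; rfl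
    have h2 := Fy 0
    rw [mul_zero, ← hfF, h1] at h2
    simp [hv, formalSolution] at h2
  · refine (sq_le_sq₀ (norm_nonneg _) (by have := sub_pos.2 hr1; positivity)).1 ?_
    have s1 := hasSum_of_even_odd_pairs (hasSum_norm_sq g)
    have s2 := (hasSum_of_boundary_pairs (hasSum_norm_sq f)).mul_left (((1 - r) / r) ^ 2)
    rw [mul_pow]
    refine hasSum_le (fun m => ?_) s1 s2
    rw [ge, go, norm_neg, norm_mul, norm_mul, Complex.norm_real, Complex.norm_real, mul_pow,
      mul_pow, Real.norm_eq_abs, Real.norm_eq_abs, sq_abs, sq_abs]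
    have h3 : ((1 - r) / r * ρ) ^ 2 ≤ ((1 - r) / r) ^ 2 := by
      rw [mul_pow]
      exact mul_le_of_le_one_right (sq_nonneg _) (by nlinarith)
    have h4 : ((1 - r) * ρ) ^ 2 ≤ ((1 - r) / r) ^ 2 := by
      have h5 : 0 < 1 - r := sub_pos.2 hr1
      refine pow_le_pow_left₀ (by positivity) ?_ 2
      rw [le_div_iff₀ hr0, mul_assoc]
      exact mul_le_of_le_one_right h5.le (by nlinarith)
    nlinarith [mul_le_mul_of_nonneg_right h3 (sq_nonneg ‖f (2 * m + 2)‖),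
      mul_le_mul_of_nonneg_right h4 (sq_nonneg ‖f (2 * m - 1)‖)]

/-- A bijective `C - z` would be bounded below, contradicting the residual `(1 - r) / r` as `r → 1`.
-/
theorem not_bijective_sub (hC : IsAlternatingCMV C η ρ) (hρ : 0 < ρ) {z : ℂ}
    (hz : ‖z‖ = 1) (hre : |z.re| ≤ ρ) :
    ¬ Function.Bijective (C - z • ContinuousLinearMap.id ℂ HalfLine) := by
  intro hb
  obtain ⟨K, hK⟩ := ContinuousLinearMap.antilipschitz_of_injective_of_isClosed_range _ hb.1
    (by rw [hb.2.range_eq]; exact isClosed_univ)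
  have hK' := ContinuousLinearMap.bound_of_antilipschitz _ hK
  have hlim : Tendsto (fun r : ℝ => K * ((1 - r) / r)) (𝓝[<] 1) (𝓝 0) := by
    have : ContinuousAt (fun r : ℝ => K * ((1 - r) / r)) 1 := by
      refine continuousAt_const.mul ((continuousAt_const.sub continuousAt_id).div continuousAt_id ?_)
      simp
    have := this.tendsto.mono_left (nhdsWithin_le_nhds (s := Iio 1))
    simpa using this
  obtain ⟨r, hr, hr0, hr1⟩ := ((hlim.eventually (gt_mem_nhds one_pos)).and
    ((eventually_gt_nhds one_pos).filter_mono nhdsWithin_le_nhds |>.and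
      self_mem_nhdsWithin)).exists
  obtain ⟨f, hf, hfle⟩ := hC.exists_approximate_eigenvector hρ hz hre hr0 hr1
  have h1 := hK' f
  have h2 : ‖f‖ ≤ K * ((1 - r) / r) * ‖f‖ := by
    rw [mul_assoc]
    exact h1.trans (mul_le_mul_of_nonneg_left hfle K.2)
  nlinarith [norm_pos_iff.2 hf]

/-- The components of an eigenvector satisfy the transfer matrix recurrence. -/
theorem eigenvector_recurrence (hC : IsAlternatingCMV C η ρ) {z : ℂ} (hz : ‖z‖ = 1)
    {f : HalfLine} (hf : C f = z • f) (m : ℕ) :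
    ρ * f (2 * m + 1) = star z * f (2 * m - 1) - η * f (2 * m) ∧
      ρ * f (2 * m + 2) = z * f (2 * m) - star η * f (2 * m - 1) := by
  have h1 : z * f (2 * m) = _ := (congrArg (fun g : HalfLine => g (2 * m)) hf).symm.trans
    (hC.even f m)
  have h2 : z * f (2 * m + 1) = _ := (congrArg (fun g : HalfLine => g (2 * m + 1)) hf).symm.trans
    (hC.odd f m)
  have hzz := mul_star_eq_one_of_norm hz
  have key := hC.eta_mul_star
  refine ⟨?_, by linear_combination -h1⟩
  linear_combination star z * ρ * h2 - ρ * f (2 * m + 1) * hzz + η * star z * h1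
    + star z * f (2 * m - 1) * key - η * f (2 * m) * hzz

/-! ### Eigenvectors and the two spectra for `ρ > 0` -/

theorem eigenvector_eq_geometric (hC : IsAlternatingCMV C η ρ) (hρ : 0 < ρ) {z : ℂ}
    (hz : ‖z‖ = 1) {f : HalfLine} (hf0 : f ≠ 0) (hf : C f = z • f) :
    f 0 ≠ 0 ∧ z.im = -η.im ∧ ∀ m, f (2 * m) = (((z.re - η.re) / ρ : ℝ) : ℂ) ^ m * f 0 := by
  have hρ' : (ρ : ℂ) ≠ 0 := by exact_mod_cast hρ.ne'
  have hzz := mul_star_eq_one_of_norm hz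
  have key := hC.eta_mul_star
  have hrec := hC.eigenvector_recurrence hz hf
  have h00 : f 0 ≠ 0 := by
    intro h0
    have hall : ∀ m, f (2 * m - 1) = 0 ∧ f (2 * m) = 0 := by
      intro m
      induction m with
      | zero => exact ⟨h0, h0⟩
      | succ m ih =>
        have := hrec m
        rw [ih.1, ih.2] at this
        simp only [mul_zero, sub_zero, mul_eq_zero, hρ', false_or] at this
        exact this
    refine hf0 (lp.ext (funext fun i => ?_))
    obtain ⟨m, rfl | rfl⟩ := Nat.even_or_odd' i
    · exact (hall m).2
    · exact (hall (m + 1)).1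
  -- Conservation of the Wronskian `x_m y_{m+1} - y_m x_{m+1}`. Times `ρ`, it is the quadratic form
  -- `(z - star z) x y - star η x² + η y²`, invariant under the transfer matrix.
  have hwr : ∀ m, f (2 * m - 1) * f (2 * m + 2) - f (2 * m) * f (2 * m + 1)
      = f 0 * (f 2 - f 1) := by
    intro m
    induction m with
    | zero => simp only [mul_zero, Nat.zero_sub, zero_add]; ring
    | succ m ih =>
      rw [← ih]
      obtain ⟨h1, h2⟩ := hrec m
      obtain ⟨h3, h4⟩ := hrec (m + 1)
      have e1 : 2 * (m + 1) - 1 = 2 * m + 1 := by omega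
      have e2 : 2 * (m + 1) = 2 * m + 2 := by omega
      rw [e1, e2] at h3 h4 ⊢
      refine mul_left_cancel₀ (pow_ne_zero 3 hρ') ?_
      linear_combination ρ ^ 2 * f (2 * m + 1) * h4 - ρ ^ 2 * f (2 * m + 2) * h3
        - ρ ^ 2 * f (2 * m - 1) * h2 + ρ ^ 2 * f (2 * m) * h1
        + (z - star z) * (ρ * f (2 * m + 2) * h1 + (star z * f (2 * m - 1) - η * f (2 * m)) * h2)
        - star η * (ρ * f (2 * m + 1) + (star z * f (2 * m - 1) - η * f (2 * m))) * h1
        + η * (ρ * f (2 * m + 2) + (z * f (2 * m) - star η * f (2 * m - 1))) * h2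
        + ((z - star z) * f (2 * m - 1) * f (2 * m) - star η * f (2 * m - 1) ^ 2
          + η * f (2 * m) ^ 2) * (hzz - key)
  have hd : f 0 * (f 2 - f 1) = 0 := by
    have hinj : ∀ (k : ℕ), Tendsto (fun m : ℕ => f (2 * m - 1 + k)) atTop (𝓝 0) := fun k =>
      (tendsto_apply_zero f).comp
        (tendsto_atTop_mono (fun m => show m ≤ _ by lia) tendsto_id)
    have hinj' : ∀ (k : ℕ), Tendsto (fun m : ℕ => f (2 * m + k)) atTop (𝓝 0) := fun k =>
      (tendsto_apply_zero f).comp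
        (tendsto_atTop_mono (fun m => show m ≤ _ by lia) tendsto_id)
    have ht := ((hinj 0).mul (hinj' 2)).sub ((hinj' 0).mul (hinj' 1))
    simp only [add_zero, hwr, mul_zero, sub_zero] at ht
    exact tendsto_nhds_unique tendsto_const_nhds ht
  have h12 : f 2 = f 1 := by
    rcases mul_eq_zero.1 hd with h | h
    · exact absurd h h00
    · exact sub_eq_zero.1 h
  obtain ⟨h1, h2⟩ := hrec 0
  simp only [mul_zero, Nat.zero_sub, zero_add] at h1 h2
  rw [h12, h1] at h2
  -- With `x_0 = y_0`, the equality `x_1 = y_1` makes `(1, 1)` an eigenvector of the transfer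
  -- matrix; the common value is real.
  have hzη : star z - η = z - star η := mul_right_cancel₀ h00 (by linear_combination h2)
  have him : z.im = -η.im := by
    have := congrArg Complex.im hzη
    simp at this
    linarith
  have hl : star z - η = ((z.re - η.re : ℝ) : ℂ) := by
    apply Complex.ext
    · simp
    · simp [him]
  have hl' : z - star η = ((z.re - η.re : ℝ) : ℂ) := hzη ▸ hl
  have hall : ∀ m, f (2 * m - 1) = (((z.re - η.re) / ρ : ℝ) : ℂ) ^ m * f 0 ∧
      f (2 * m) = (((z.re - η.re) / ρ : ℝ) : ℂ) ^ m * f 0 := by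
    intro m
    induction m with
    | zero => simp
    | succ m ih =>
      obtain ⟨h3, h4⟩ := hrec m
      have e1 : 2 * (m + 1) - 1 = 2 * m + 1 := by omega
      have e2 : 2 * (m + 1) = 2 * m + 2 := by omega
      rw [e1, e2]
      rw [ih.1, ih.2, ← sub_mul, hl] at h3
      rw [ih.1, ih.2, ← sub_mul, hl'] at h4
      rw [pow_succ, Complex.ofReal_div]
      rw [Complex.ofReal_div] at h3 h4
      constructor
      · field_simp at h3 ⊢; linear_combination h3
      · field_simp at h4 ⊢; linear_combination h4
  exact ⟨h00, him, fun m => (hall m).2⟩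

/-- Using `|z| = 1`, `Im z = -Im η` and `ρ² = 1 - |η|²`, the condition `|l| < 1` reduces to `(Re η)²
< Re z * Re η`. As `ρ > 0` gives `|Re η| < |Re z|`, only the sign of the product matters. -/
theorem pointSpectrum_eq (hC : IsAlternatingCMV C η ρ) (hρ : 0 < ρ) :
    pointSpectrum C = {z | ‖z‖ = 1 ∧ z.im = -η.im ∧ 0 < z.re * η.re} := by
  have hρ' : (ρ : ℂ) ≠ 0 := by exact_mod_cast hρ.ne'
  have hs := hC.sq_add_sq
  rw [norm_sq_eq_re_sq_add_im_sq] at hs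
  ext z
  constructor
  · intro hz
    have hz1 := hC.pointSpectrum_norm_eq_one hz
    obtain ⟨f, hf0, hf⟩ := mem_pointSpectrum_iff.1 hz
    obtain ⟨h0, him, hgeo⟩ := hC.eigenvector_eq_geometric hρ hz1 hf0 hf
    refine ⟨hz1, him, ?_⟩
    have ht : Tendsto (fun m : ℕ => f (2 * m)) atTop (𝓝 0) :=
      (tendsto_apply_zero f).comp
        (tendsto_atTop_mono (fun m => show m ≤ _ by lia) tendsto_id)
    simp only [hgeo] at ht
    have ht2 := ht.mul_const (f 0)⁻¹
    simp only [mul_assoc, mul_inv_cancel₀ h0, mul_one, zero_mul] at ht2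
    have hl : |(z.re - η.re) / ρ| < 1 := by
      refine tendsto_pow_atTop_nhds_zero_iff.1 ?_
      have := (Complex.continuous_re.tendsto 0).comp ht2
      simpa [Function.comp_def, ← Complex.ofReal_pow, -Complex.ofReal_div] using this
    rw [abs_div, abs_of_pos hρ, div_lt_one hρ] at hl
    have h1 : (z.re - η.re) ^ 2 < ρ ^ 2 := sq_lt_sq' (by linarith [(abs_lt.1 hl).1]) (abs_lt.1 hl).2
    have h2 : z.re ^ 2 + z.im ^ 2 = 1 := by rw [← norm_sq_eq_re_sq_add_im_sq, hz1]; norm_num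
    rw [him] at h2
    nlinarith [sq_nonneg η.re]
  · rintro ⟨hz1, him, hpos⟩
    have hzz := mul_star_eq_one_of_norm hz1
    have key := hC.eta_mul_star
    have h2 : z.re ^ 2 + z.im ^ 2 = 1 := by rw [← norm_sq_eq_re_sq_add_im_sq, hz1]; norm_num
    set l : ℝ := (z.re - η.re) / ρ with hldef
    have hl : |l| < 1 := by
      rw [hldef, abs_div, abs_of_pos hρ, div_lt_one hρ]
      refine abs_lt_of_sq_lt_sq ?_ hρ.le
      rw [him] at h2
      have h3 : η.re ^ 2 < z.re ^ 2 := by nlinarith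
      have h4 : |η.re| < |z.re| := sq_lt_sq.1 h3
      have h5 : η.re ^ 2 < z.re * η.re := by
        rw [← abs_of_pos hpos, abs_mul, ← sq_abs, sq]
        refine mul_lt_mul_of_pos_right h4 (abs_pos.2 ?_)
        rintro h; simp [h] at hpos
      nlinarith
    -- The exponent equals `m` at both `2m-1` and `2m`, including `m = 0`.
    let F : ℕ → ℂ := fun i => (l : ℂ) ^ ((i + 1) / 2)
    have Fx : ∀ m, F (2 * m - 1) = (l : ℂ) ^ m := by
      intro m
      have : (2 * m - 1 + 1) / 2 = m := by omega
      simp [F, this]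
    have Fy : ∀ m, F (2 * m) = (l : ℂ) ^ m := by
      intro m
      have : (2 * m + 1) / 2 = m := by omega
      simp [F, this]
    have hsum : Summable fun m : ℕ => ‖(l : ℂ) ^ m‖ ^ 2 := by
      have h3 : ∀ m : ℕ, ‖(l : ℂ) ^ m‖ ^ 2 = (|l| ^ 2) ^ m := fun m => by
        rw [norm_pow, Complex.norm_real, Real.norm_eq_abs]; ring
      simp only [h3]
      exact summable_geometric_of_lt_one (by positivity) (by nlinarith [abs_nonneg l])
    have hF : Summable fun i => ‖F i‖ ^ 2 := by
      have hx' : Summable fun m => ‖F (2 * m + 1)‖ ^ 2 := by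
        refine ((summable_nat_add_iff 1).2 hsum).congr fun m => ?_
        rw [← Fx]; rfl
      have hy' : Summable fun m => ‖F (2 * m)‖ ^ 2 := hsum.congr fun m => by rw [← Fy]
      exact (hy'.hasSum.even_add_odd (f := fun n => ‖F n‖ ^ 2) hx'.hasSum).summable
    have hlz : ρ * (l : ℂ) = z - star η := by
      rw [hldef]
      push_cast
      field_simp
      apply Complex.ext
      · simp
      · simp [him]
    have hlz' : ρ * (l : ℂ) = star z - η := by
      rw [hldef]
      push_cast
      field_simp
      apply Complex.ext
      · simp
      · simp [him]
    refine mem_pointSpectrum_iff.2 ⟨⟨F, memlp_two_of_summable hF⟩, fun h0 => ?_, ?_⟩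
    · have : F 0 = 0 := congrArg (fun g : HalfLine => g 0) h0
      simp [F] at this
    · ext i
      obtain ⟨m, rfl | rfl⟩ := Nat.even_or_odd' i
      · rw [hC.even]
        change star η * F (2 * m - 1) + ρ * F (2 * (m + 1)) = z * F (2 * m)
        rw [Fx, Fy, Fy, pow_succ]
        linear_combination (l : ℂ) ^ m * hlz
      · rw [hC.odd]
        change ρ * F (2 * m - 1) - η * F (2 * (m + 1)) = z * F (2 * (m + 1) - 1)
        rw [Fx, Fx, Fy, pow_succ]
        refine mul_left_cancel₀ hρ' ?_
        linear_combination (-η * l ^ m) * hlz - z * l ^ m * hlz' + l ^ m * (key - hzz)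

theorem continuousSpectrum_eq (hC : IsAlternatingCMV C η ρ) (hρ : 0 < ρ) :
    continuousSpectrum C = {z | ‖z‖ = 1 ∧ |z.re| ≤ ρ} := by
  ext z
  constructor
  · intro hz
    have hz1 := hC.norm_eq_one_of_mem_spectrum (continuousSpectrum_subset_spectrum C hz)
    refine ⟨hz1, not_lt.1 fun hlt => hz.2.2 ?_⟩
    exact hC.surjective_sub hz1 hlt (notMem_pointSpectrum_iff.2 hz.1)
  · rintro ⟨hz1, hre⟩
    have hspec := mem_spectrum_iff_not_bijective.2 (hC.not_bijective_sub hρ hz1 hre)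
    rw [hC.spectrum_eq] at hspec
    refine hspec.resolve_right fun hp => ?_
    rw [hC.pointSpectrum_eq hρ] at hp
    obtain ⟨-, him, hpos⟩ := hp
    have hs := hC.sq_add_sq
    have h2 : z.re ^ 2 + z.im ^ 2 = 1 := by rw [← norm_sq_eq_re_sq_add_im_sq, hz1]; norm_num
    rw [norm_sq_eq_re_sq_add_im_sq] at hs
    rw [him] at h2
    have h3 : z.re ^ 2 ≤ ρ ^ 2 := sq_le_sq' (abs_le.1 hre).1 (abs_le.1 hre).2
    -- Here `(Re z)² = 1 - (Im η)² = ρ² + (Re η)²`, so an eigenvalue on a band would have `Re η =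
    -- 0`.
    have h4 : η.re = 0 := by nlinarith [sq_nonneg η.re]
    simp [h4] at hpos

end IsAlternatingCMV

/-! ### The degenerate case `ρ = 0` -/

/-- The eigenvector of the degenerate operator supported on the block `{2m + 1, 2m + 2}`. -/
noncomputable def blockVector (η z : ℂ) (m : ℕ) : HalfLine :=
  lp.single 2 (2 * m + 1) z + lp.single 2 (2 * m + 2) (star η)

theorem blockVector_apply (η z : ℂ) (m i : ℕ) :
    blockVector η z m i =
      (if i = 2 * m + 1 then z else 0) + (if i = 2 * m + 2 then star η else 0) := by
  change lp.single (E := fun _ : ℕ => ℂ) 2 (2 * m + 1) z i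
    + lp.single (E := fun _ : ℕ => ℂ) 2 (2 * m + 2) (star η) i = _
  rw [lp.single_apply, lp.single_apply, Pi.single_apply, Pi.single_apply]

namespace IsAlternatingCMV

variable {C : HalfLine →L[ℂ] HalfLine} {η : ℂ}

/-- On each block `{2m+1, 2m+2}` one has `C² = -1`, so an eigenvector for any other `z` is supported
at the site 0. -/
theorem eigenvector_degenerate (hC : IsAlternatingCMV C η 0) {z : ℂ}
    {f : HalfLine} (hf : C f = z • f) (hz : z ^ 2 ≠ -1) : ∀ i, f (i + 1) = 0 := by
  have hη : η * star η = 1 := by simpa using hC.eta_mul_star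
  have hy : ∀ m, f (2 * m + 2) = 0 ∧ f (2 * m + 1) = 0 := by
    intro m
    have h1 : z * f (2 * (m + 1)) = _ :=
      (congrArg (fun g : HalfLine => g (2 * (m + 1))) hf).symm.trans (hC.even f (m + 1))
    have h2 : z * f (2 * m + 1) = _ :=
      (congrArg (fun g : HalfLine => g (2 * m + 1)) hf).symm.trans (hC.odd f m)
    have e1 : 2 * (m + 1) - 1 = 2 * m + 1 := by omega
    have e2 : 2 * (m + 1) = 2 * m + 2 := by omega
    rw [e1, e2] at h1
    simp only [Complex.ofReal_zero, zero_mul, add_zero, zero_sub] at h1 h2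
    have h3 : (z ^ 2 + 1) * f (2 * m + 2) = 0 := by
      linear_combination z * h1 + star η * h2 - f (2 * m + 2) * hη
    have h4 : f (2 * m + 2) = 0 :=
      (mul_eq_zero.1 h3).resolve_left fun h => hz (eq_neg_of_add_eq_zero_left h)
    rw [h4, mul_zero] at h1
    refine ⟨h4, ?_⟩
    have hη0 : star η ≠ 0 := fun h => by simp [h] at hη
    exact (mul_eq_zero.1 h1.symm).resolve_left hη0
  intro i
  obtain ⟨m, rfl | rfl⟩ := Nat.even_or_odd' i
  · exact (hy m).2
  · exact (hy m).1

theorem finiteDimensional_eigenspace_degenerate (hC : IsAlternatingCMV C η 0) {z : ℂ}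
    (hz : z ^ 2 ≠ -1) :
    FiniteDimensional ℂ (Module.End.eigenspace (C : HalfLine →ₗ[ℂ] HalfLine) z) := by
  refine FiniteDimensional.of_injective (K := ℂ) (V₂ := ℂ)
    ((lp.evalCLM ℂ (fun _ : ℕ => ℂ) 2 0 : HalfLine →ₗ[ℂ] ℂ).comp
      (Module.End.eigenspace (C : HalfLine →ₗ[ℂ] HalfLine) z).subtype) ?_
  rw [injective_iff_map_eq_zero]
  rintro ⟨f, hf⟩ h0
  have h1 := hC.eigenvector_degenerate (Module.End.mem_eigenspace_iff.1 hf) hz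
  refine Subtype.ext (lp.ext (funext fun i => ?_))
  rcases i with _ | i
  · exact h0
  · exact h1 i

theorem apply_blockVector (hC : IsAlternatingCMV C η 0) {z : ℂ} (hz : z ^ 2 = -1) (m : ℕ) :
    C (blockVector η z m) = z • blockVector η z m := by
  have hη : η * star η = 1 := by simpa using hC.eta_mul_star
  ext i
  obtain ⟨n, rfl | rfl⟩ := Nat.even_or_odd' i
  · rw [hC.even]
    change _ = z * blockVector η z m (2 * n)
    rw [Complex.ofReal_zero, zero_mul, add_zero, blockVector_apply, blockVector_apply]
    by_cases h : n = m + 1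
    · subst h
      rw [if_pos (by omega), if_neg (by omega), if_neg (by omega), if_pos (by omega)]
      ring
    · rw [if_neg (by omega), if_neg (by omega), if_neg (by omega), if_neg (by omega)]
      ring
  · rw [hC.odd]
    change _ = z * blockVector η z m (2 * n + 1)
    rw [Complex.ofReal_zero, zero_mul, zero_sub, blockVector_apply, blockVector_apply]
    by_cases h : n = m
    · subst h
      rw [if_neg (by omega), if_pos (by omega), if_pos (by omega), if_neg (by omega)]
      linear_combination -hz - hη
    · rw [if_neg (by omega), if_neg (by omega), if_neg (by omega), if_neg (by omega)]
      ring

theorem not_finiteDimensional_eigenspace_degenerate (hC : IsAlternatingCMV C η 0) {z : ℂ}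
    (hz : z ^ 2 = -1) :
    ¬ FiniteDimensional ℂ (Module.End.eigenspace (C : HalfLine →ₗ[ℂ] HalfLine) z) := by
  intro hfd
  have hz0 : z ≠ 0 := by rintro rfl; norm_num at hz
  let v : ℕ → Module.End.eigenspace (C : HalfLine →ₗ[ℂ] HalfLine) z := fun m =>
    ⟨blockVector η z m, Module.End.mem_eigenspace_iff.2 (hC.apply_blockVector hz m)⟩
  have hv : LinearIndependent ℂ v := by
    rw [linearIndependent_iff']
    intro s c hs n hn
    -- The blocks have disjoint supports, so evaluation at `2n+1` isolates the coefficient `c n`.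
    have h1 := congrArg (fun w : Module.End.eigenspace (C : HalfLine →ₗ[ℂ] HalfLine) z =>
      lp.evalCLM ℂ (fun _ : ℕ => ℂ) 2 (2 * n + 1) (w : HalfLine)) hs
    have h2 : ∀ m, lp.evalCLM ℂ (fun _ : ℕ => ℂ) 2 (2 * n + 1) (v m : HalfLine)
        = if m = n then z else 0 := by
      intro m
      change blockVector η z m (2 * n + 1) = _
      rw [blockVector_apply, if_neg (show 2 * n + 1 ≠ 2 * m + 2 by omega), add_zero]
      exact if_congr (by omega) rfl rfl
    simp only [Submodule.coe_sum, Submodule.coe_smul, map_sum, map_smul, h2, smul_eq_mul,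
      mul_ite, mul_zero, Finset.sum_ite_eq', hn, if_true, ZeroMemClass.coe_zero, map_zero] at h1
    exact (mul_eq_zero.1 h1).resolve_right hz0
  exact not_finite_iff_infinite.2 inferInstance hv.finite

theorem pointSpectrum_eq_degenerate (hC : IsAlternatingCMV C η 0) :
    pointSpectrum C = {z | z ^ 2 = -1 ∨ z = star η} := by
  ext z
  constructor
  · intro hz
    by_contra hcon
    simp only [mem_ofPred_eq, not_or] at hcon
    obtain ⟨f, hf0, hf⟩ := mem_pointSpectrum_iff.1 hz
    have h1 := hC.eigenvector_degenerate hf hcon.1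
    have h2 : z * f 0 = _ := (congrArg (fun g : HalfLine => g (2 * 0)) hf).symm.trans (hC.even f 0)
    simp only [mul_zero, Nat.zero_sub, Complex.ofReal_zero, zero_mul, add_zero] at h2
    refine hf0 (lp.ext (funext fun i => ?_))
    rcases i with _ | i
    · by_contra h0
      exact hcon.2 (mul_right_cancel₀ h0 h2)
    · exact h1 i
  · rintro (hz | rfl)
    · refine mem_pointSpectrum_iff.2 ⟨_, fun h0 => ?_, hC.apply_blockVector hz 0⟩
      have h1 : blockVector η z 0 1 = 0 := congrArg (fun g : HalfLine => g 1) h0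
      rw [blockVector_apply] at h1
      simp at h1
      simp [h1] at hz
    · refine mem_pointSpectrum_iff.2 ⟨lp.single 2 0 1, fun h0 => ?_, ?_⟩
      · have := congrArg (fun g : HalfLine => g 0) h0
        simp at this
      · ext i
        obtain ⟨n, rfl | rfl⟩ := Nat.even_or_odd' i
        · rw [hC.even]
          rcases n with _ | n
          · simp
          · have e1 : 2 * (n + 1) - 1 = 2 * n + 1 := by omega
            simp [e1]
        · rw [hC.odd]
          simp

/-- `surjective_sub` with `ρ = 0` covers `Re z ≠ 0`; on the circle this leaves only `±i`, which are
eigenvalues. -/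
theorem continuousSpectrum_eq_empty_degenerate (hC : IsAlternatingCMV C η 0) :
    continuousSpectrum C = ∅ := by
  rw [Set.eq_empty_iff_forall_notMem]
  intro z hz
  have hz1 := hC.norm_eq_one_of_mem_spectrum (continuousSpectrum_subset_spectrum C hz)
  have hp := notMem_pointSpectrum_iff.2 hz.1
  refine hz.2.2 (hC.surjective_sub hz1 (abs_pos.2 fun h0 => hp ?_) hp)
  rw [hC.pointSpectrum_eq_degenerate]
  left
  have h2 : z.re ^ 2 + z.im ^ 2 = 1 := by
    rw [← norm_sq_eq_re_sq_add_im_sq, hz1]; norm_num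
  apply Complex.ext
  · simp [sq, h0] at h2 ⊢; linarith
  · simp [sq, h0]

end IsAlternatingCMV

/-! ### Quasi-energies: band and edge angles -/

theorem exp_I_mul_re (θ : ℝ) : (Complex.exp (Complex.I * θ)).re = Real.cos θ := by
  rw [mul_comm, Complex.exp_ofReal_mul_I_re]

theorem exp_I_mul_im (θ : ℝ) : (Complex.exp (Complex.I * θ)).im = Real.sin θ := by
  rw [mul_comm, Complex.exp_ofReal_mul_I_im]

theorem norm_exp_I_mul (θ : ℝ) : ‖Complex.exp (Complex.I * θ)‖ = 1 := by
  rw [mul_comm, Complex.norm_exp_ofReal_mul_I]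

theorem eta_re (α β k : ℝ) : (eta α β k).re = -(Real.cos k * Real.sin (α + β)) := by
  rw [eta_eq]

theorem eta_im (α β k : ℝ) : (eta α β k).im = Real.sin k * Real.sin (α - β) := by
  rw [eta_eq]

theorem one_sub_norm_eta_sq (α β k : ℝ) : 1 - ‖eta α β k‖ ^ 2 =
    Real.cos (α - β) ^ 2 - Real.sin (2 * α) * Real.sin (2 * β) * Real.cos k ^ 2 := by
  have h : Real.sin (2 * α) * Real.sin (2 * β) =
      Real.sin (α + β) ^ 2 - Real.sin (α - β) ^ 2 := by
    rw [Real.sin_two_mul, Real.sin_two_mul, Real.sin_add, Real.sin_sub]; ring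
  rw [norm_sq_eq_re_sq_add_im_sq, eta_re, eta_im, h]
  linear_combination (-Real.sin (α - β) ^ 2) * Real.sin_sq_add_cos_sq k
    - Real.sin_sq_add_cos_sq (α - β)

theorem cos_thetaC (α β k : ℝ) : Real.cos (thetaC α β k) = √(1 - ‖eta α β k‖ ^ 2) := by
  rw [thetaC, ← one_sub_norm_eta_sq]
  refine Real.cos_arccos (by linarith [Real.sqrt_nonneg (1 - ‖eta α β k‖ ^ 2)]) ?_
  exact Real.sqrt_le_one.2 (by nlinarith [sq_nonneg ‖eta α β k‖])

theorem thetaC_mem_Icc (α β k : ℝ) : thetaC α β k ∈ Icc 0 (Real.pi / 2) :=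
  ⟨Real.arccos_nonneg _, Real.arccos_le_pi_div_two.2 (Real.sqrt_nonneg _)⟩

theorem mem_Icc_iff_abs_cos_le {φ θ : ℝ} (hφ : φ ∈ Icc 0 (Real.pi / 2))
    (hθ : θ ∈ Icc 0 Real.pi) :
    θ ∈ Icc φ (Real.pi - φ) ↔ |Real.cos θ| ≤ Real.cos φ := by
  have hpi := Real.pi_pos
  have hφ' : φ ∈ Icc 0 Real.pi := ⟨hφ.1, by linarith [hφ.2]⟩
  have hφ'' : Real.pi - φ ∈ Icc 0 Real.pi := ⟨by linarith [hφ'.2], by linarith [hφ.1]⟩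
  have h1 := Real.strictAntiOn_cos.le_iff_ge hθ hφ'
  have h2 := Real.strictAntiOn_cos.le_iff_ge hφ'' hθ
  rw [Real.cos_pi_sub] at h2
  rw [abs_le, h1, h2, mem_Icc, and_comm]

theorem mem_bands_iff {α β k θ : ℝ} (hθ : θ ∈ Ico 0 (2 * Real.pi)) :
    θ ∈ bands α β k ↔ |Real.cos θ| ≤ √(1 - ‖eta α β k‖ ^ 2) := by
  have hφ := thetaC_mem_Icc α β k
  have hpi := Real.pi_pos
  rw [← cos_thetaC, bands]
  set φ := thetaC α β k
  rcases le_or_gt θ Real.pi with h | h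
  · rw [← mem_Icc_iff_abs_cos_le hφ ⟨hθ.1, h⟩]
    refine ⟨?_, Or.inl⟩
    rintro (h' | h')
    · exact h'
    · exact ⟨by linarith [h'.1, hφ.2, hφ.1], by linarith [h'.1, hφ.1]⟩
  -- Translation by `π` carries the second band to the first and preserves `|cos|`.
  · rw [← abs_neg, ← Real.cos_sub_pi,
      ← mem_Icc_iff_abs_cos_le hφ ⟨by linarith, by linarith [hθ.2]⟩]
    constructor
    · rintro (h' | h')
      · linarith [h'.2, hφ.1]
      · exact ⟨by linarith [h'.1], by linarith [h'.2]⟩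
    · intro h'
      exact Or.inr ⟨by linarith [h'.1], by linarith [h'.2]⟩

theorem angleRep_mem_Ico (θ : ℝ) : angleRep θ ∈ Ico 0 (2 * Real.pi) := by
  simpa [angleRep] using toIcoMod_mem_Ico Real.two_pi_pos 0 θ

theorem exp_I_mul_angleRep (θ : ℝ) :
    Complex.exp (Complex.I * angleRep θ) = Complex.exp (Complex.I * θ) := by
  rw [Complex.exp_eq_exp_iff_exists_int]
  refine ⟨-toIcoDiv Real.two_pi_pos 0 θ, ?_⟩
  rw [angleRep, toIcoMod]
  push_cast
  rw [zsmul_eq_mul]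
  ring

theorem exp_I_mul_injOn : InjOn (fun θ : ℝ => Complex.exp (Complex.I * θ))
    (Ico 0 (2 * Real.pi)) := by
  intro θ hθ φ hφ h
  obtain ⟨n, hn⟩ := Complex.exp_eq_exp_iff_exists_int.1 h
  have h1 : (θ : ℂ) = φ + n * (2 * Real.pi) :=
    mul_left_cancel₀ Complex.I_ne_zero (by linear_combination hn)
  have h2 : θ = φ + n * (2 * Real.pi) := by exact_mod_cast h1
  have hpi := Real.two_pi_pos
  have h3 : (n : ℝ) < 1 := by
    by_contra hlt
    nlinarith [hθ.2, hφ.1]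
  have h4 : (-1 : ℝ) < n := by
    by_contra hlt
    nlinarith [hθ.1, hφ.2]
  have h5 : n = 0 := by
    have h3' : n < 1 := by exact_mod_cast h3
    have h4' : -1 < n := by exact_mod_cast h4
    omega
  simpa [h5] using h2

theorem exists_angle {z : ℂ} (hz : ‖z‖ = 1) :
    ∃ θ ∈ Ico 0 (2 * Real.pi), Complex.exp (Complex.I * θ) = z := by
  refine ⟨angleRep z.arg, angleRep_mem_Ico _, ?_⟩
  rw [exp_I_mul_angleRep, mul_comm]
  simpa [hz] using Complex.norm_mul_exp_arg_mul_I z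

theorem abs_cos_le_of_mem_bands {α β k θ : ℝ} (hθ : θ ∈ bands α β k) :
    |Real.cos θ| ≤ √(1 - ‖eta α β k‖ ^ 2) := by
  have hφ := thetaC_mem_Icc α β k
  have hpi := Real.pi_pos
  have h0 : 0 ≤ θ := by
    rcases hθ with h | h
    · exact hφ.1.trans h.1
    · linarith [h.1, hφ.1]
  rcases lt_or_ge θ (2 * Real.pi) with h | h
  · exact (mem_bands_iff ⟨h0, h⟩).1 hθ
  -- The bands can reach `2π` only when `θ_c = 0`, and then the bound on `|cos θ|` is 1.
  · have h1 : thetaC α β k = 0 := by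
      rcases hθ with h' | h'
      · linarith [h'.2, hφ.1]
      · exact le_antisymm (by linarith [h'.2]) hφ.1
    rw [← cos_thetaC, h1, Real.cos_zero]
    exact Real.abs_cos_le_one θ

theorem image_bands (α β k : ℝ) :
    (fun θ : ℝ => Complex.exp (Complex.I * θ)) '' bands α β k =
      {z | ‖z‖ = 1 ∧ |z.re| ≤ √(1 - ‖eta α β k‖ ^ 2)} := by
  ext z
  constructor
  · rintro ⟨θ, hθ, rfl⟩
    refine ⟨norm_exp_I_mul θ, ?_⟩
    rw [exp_I_mul_re]
    exact abs_cos_le_of_mem_bands hθ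
  · rintro ⟨hz, hre⟩
    obtain ⟨θ, hθ, rfl⟩ := exists_angle hz
    rw [exp_I_mul_re] at hre
    exact ⟨θ, (mem_bands_iff hθ).2 hre, rfl⟩

theorem cos_eq_zero_iff_of_mem_Ico {k : ℝ} (hk : k ∈ Ico 0 (2 * Real.pi)) :
    Real.cos k = 0 ↔ k = Real.pi / 2 ∨ k = 3 * Real.pi / 2 := by
  have hpi := Real.pi_pos
  constructor
  · intro h
    obtain ⟨n, hn⟩ := Real.cos_eq_zero_iff.1 h
    have h1 : (-1 : ℝ) < n := by
      by_contra hlt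
      nlinarith [hk.1]
    have h2 : (n : ℝ) < 2 := by
      by_contra hlt
      nlinarith [hk.2]
    have h1' : -1 < n := by exact_mod_cast h1
    have h2' : n < 2 := by exact_mod_cast h2
    obtain rfl | rfl : n = 0 ∨ n = 1 := by omega
    · left; rw [hn]; push_cast; ring
    · right; rw [hn]; push_cast; ring
  · rintro (rfl | rfl)
    · exact Real.cos_pi_div_two
    · rw [show 3 * Real.pi / 2 = Real.pi / 2 + Real.pi by ring, Real.cos_add_pi,
        Real.cos_pi_div_two, neg_zero]

theorem eta_re_ne_zero_iff {α β k : ℝ} (hk : k ∈ Ico 0 (2 * Real.pi)) :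
    (eta α β k).re ≠ 0 ↔ Real.sin (α + β) ≠ 0 ∧ k ≠ Real.pi / 2 ∧ k ≠ 3 * Real.pi / 2 := by
  rw [eta_re, neg_ne_zero, mul_ne_zero_iff, ne_eq, cos_eq_zero_iff_of_mem_Ico hk]
  tauto

theorem sin_theta0 (α β k : ℝ) : Real.sin (theta0 α β k) = -(eta α β k).im := by
  have h : |(eta α β k).im| ≤ 1 := (Complex.abs_im_le_norm _).trans (eta_norm_le α β k)
  rw [eta_im] at h ⊢
  have h' := abs_le.1 h
  rw [theta0]
  split_ifs
  · exact Real.sin_arcsin (by linarith) (by linarith)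
  · rw [Real.sin_pi_sub]
    exact Real.sin_arcsin (by linarith) (by linarith)

/-- When `Re η ≠ 0`, `|Im η| < 1`, so the arcsine has positive cosine; the case split in `theta0`
then supplies the sign of `Re η`. -/
theorem cos_theta0_mul_eta_re_pos {α β k : ℝ} (h : (eta α β k).re ≠ 0) :
    0 < Real.cos (theta0 α β k) * (eta α β k).re := by
  have hpos : 0 < Real.cos (Real.arcsin (-(Real.sin k * Real.sin (α - β)))) := by
    rw [Real.cos_arcsin, Real.sqrt_pos, ← eta_im]
    have h1 := norm_sq_eq_re_sq_add_im_sq (eta α β k)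
    have h2 := eta_norm_le α β k
    have h3 : 0 < (eta α β k).re ^ 2 := by positivity
    nlinarith [norm_nonneg (eta α β k)]
  rw [eta_re] at h ⊢
  rw [theta0]
  split_ifs with hc
  · refine mul_pos hpos (lt_of_le_of_ne (by linarith) h.symm)
  · rw [Real.cos_pi_sub]
    exact mul_pos_of_neg_of_neg (by linarith) (by linarith)

theorem eq_exp_theta0_iff {α β k : ℝ} (h : (eta α β k).re ≠ 0) {z : ℂ} :
    z = Complex.exp (Complex.I * theta0 α β k) ↔
      ‖z‖ = 1 ∧ z.im = -(eta α β k).im ∧ 0 < z.re * (eta α β k).re := by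
  have hpos := cos_theta0_mul_eta_re_pos h
  constructor
  · rintro rfl
    rw [exp_I_mul_re, exp_I_mul_im, sin_theta0]
    exact ⟨norm_exp_I_mul _, rfl, hpos⟩
  · rintro ⟨hz, him, hre⟩
    apply Complex.ext
    · rw [exp_I_mul_re]
      have h1 := norm_sq_eq_re_sq_add_im_sq z
      have h2 := Real.sin_sq_add_cos_sq (theta0 α β k)
      rw [sin_theta0] at h2
      rw [hz, him] at h1
      rcases sq_eq_sq_iff_eq_or_eq_neg.1
        (show z.re ^ 2 = Real.cos (theta0 α β k) ^ 2 by linarith) with h3 | h3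
      · exact h3
      · rw [h3] at hre
        linarith
    · rw [exp_I_mul_im, sin_theta0, him]

theorem edge_condition_iff {α β k : ℝ} (hk : k ∈ Ico 0 (2 * Real.pi)) {z : ℂ} :
    (‖z‖ = 1 ∧ z.im = -(eta α β k).im ∧ 0 < z.re * (eta α β k).re) ↔
      Real.sin (α + β) ≠ 0 ∧ k ≠ Real.pi / 2 ∧ k ≠ 3 * Real.pi / 2 ∧
        z = Complex.exp (Complex.I * theta0 α β k) := by
  constructor
  · intro h
    have h0 : (eta α β k).re ≠ 0 := by
      intro h0
      simp [h0] at h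
    obtain ⟨h1, h2, h3⟩ := (eta_re_ne_zero_iff hk).1 h0
    exact ⟨h1, h2, h3, (eq_exp_theta0_iff h0).2 h⟩
  · rintro ⟨h1, h2, h3, h4⟩
    exact (eq_exp_theta0_iff ((eta_re_ne_zero_iff hk).2 ⟨h1, h2, h3⟩)).1 h4

/-! ### Spectra of `cmvAt` and the dispersion relations -/

theorem rho_pos {α β k : ℝ} (h : ‖eta α β k‖ < 1) : 0 < √(1 - ‖eta α β k‖ ^ 2) :=
  Real.sqrt_pos.2 (by nlinarith [norm_nonneg (eta α β k)])

theorem continuousSpectrum_cmvAt {α β k : ℝ} (hk : k ∈ regularWaveNumbers α β) :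
    continuousSpectrum (cmvAt α β k) =
      (fun θ : ℝ => Complex.exp (Complex.I * θ)) '' bands α β k := by
  rw [image_bands, (cmvAt_isAlternatingCMV α β k).continuousSpectrum_eq (rho_pos hk.2)]

theorem pointSpectrum_cmvAt {α β k : ℝ} (hk : k ∈ regularWaveNumbers α β) :
    pointSpectrum (cmvAt α β k) =
      {z : ℂ | Real.sin (α + β) ≠ 0 ∧ k ≠ Real.pi / 2 ∧ k ≠ 3 * Real.pi / 2 ∧
        z = Complex.exp (Complex.I * theta0 α β k)} := by
  rw [(cmvAt_isAlternatingCMV α β k).pointSpectrum_eq (rho_pos hk.2)]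
  ext z
  exact edge_condition_iff hk.1

theorem exp_mem_continuousSpectrum_iff {α β k θ : ℝ} (hk : k ∈ regularWaveNumbers α β)
    (hθ : θ ∈ Ico 0 (2 * Real.pi)) :
    Complex.exp (Complex.I * θ) ∈ continuousSpectrum (cmvAt α β k) ↔ θ ∈ bands α β k := by
  rw [continuousSpectrum_cmvAt hk, image_bands, mem_bands_iff hθ, mem_ofPred_eq, exp_I_mul_re]
  exact and_iff_right (norm_exp_I_mul θ)

theorem Bu_eq (α β : ℝ) : Bu α β = {p : ℝ × ℝ | p.1 ∈ regularWaveNumbers α β ∧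
    p.2 ∈ bands α β p.1 ∩ Ico 0 (2 * Real.pi)} := by
  ext p
  constructor
  · rintro ⟨hk, hθ, hp⟩
    exact ⟨hk, (exp_mem_continuousSpectrum_iff hk hθ).1 hp, hθ⟩
  · rintro ⟨hk, hp, hθ⟩
    exact ⟨hk, hθ, (exp_mem_continuousSpectrum_iff hk hθ).2 hp⟩

theorem Ed_eq {α β : ℝ} (h : Real.sin (α + β) ≠ 0) : Ed α β =
    {p : ℝ × ℝ | ∃ k ∈ regularWaveNumbers α β \ {Real.pi / 2, 3 * Real.pi / 2},
      p = (k, angleRep (theta0 α β k))} := by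
  ext ⟨k, θ⟩
  constructor
  · rintro ⟨hk, hθ, hp⟩
    simp only [pointSpectrum_cmvAt hk] at hp
    obtain ⟨-, h1, h2, h3⟩ := hp
    refine ⟨k, ⟨hk, by simp [h1, h2]⟩, Prod.ext rfl ?_⟩
    refine exp_I_mul_injOn hθ (angleRep_mem_Ico _) ?_
    simp only [exp_I_mul_angleRep, h3]
  · rintro ⟨k', ⟨hk, hk'⟩, hp⟩
    obtain ⟨rfl, rfl⟩ := Prod.mk.inj hp
    simp only [mem_insert_iff, mem_singleton_iff, not_or] at hk'
    refine ⟨hk, angleRep_mem_Ico _, ?_⟩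
    simp only [pointSpectrum_cmvAt hk, exp_I_mul_angleRep]
    exact ⟨h, hk'.1, hk'.2, rfl⟩

theorem Ed_eq_empty {α β : ℝ} (h : Real.sin (α + β) = 0) : Ed α β = ∅ := by
  rw [eq_empty_iff_forall_notMem]
  rintro p ⟨hk, -, hp⟩
  rw [pointSpectrum_cmvAt hk] at hp
  exact hp.1 h

/-- Identifies the eigenvalues `±i` of the blocks with the bands at `ρ = 0`. -/
theorem sq_eq_neg_one_iff {z : ℂ} : z ^ 2 = -1 ↔ ‖z‖ = 1 ∧ |z.re| ≤ 0 := by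
  have hn := norm_sq_eq_re_sq_add_im_sq z
  constructor
  · intro h
    have h1 : ‖z‖ = 1 := by
      have : ‖z‖ ^ 2 = 1 := by rw [← norm_pow, h]; simp
      exact (pow_eq_one_iff_of_nonneg (norm_nonneg z) two_ne_zero).1 this
    refine ⟨h1, ?_⟩
    have h2 := congrArg Complex.re h
    simp only [sq, Complex.mul_re, Complex.neg_re, Complex.one_re] at h2
    rw [h1] at hn
    have h3 : z.re = 0 := by nlinarith
    simp [h3]
  · rintro ⟨h1, h2⟩
    have h3 : z.re = 0 := abs_nonpos_iff.1 h2
    rw [h1, h3] at hn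
    apply Complex.ext
    · simp [sq, h3]
      linarith
    · simp [sq, h3]

theorem degenerate_spectrum {α β k : ℝ} (hk : k ∈ Ico 0 (2 * Real.pi))
    (hη : ‖eta α β k‖ = 1) :
    continuousSpectrum (cmvAt α β k) = ∅ ∧
      spectrum ℂ (cmvAt α β k) = pointSpectrum (cmvAt α β k) ∧
      {z ∈ pointSpectrum (cmvAt α β k) | ¬ FiniteDimensional ℂ (Module.End.eigenspace
            (cmvAt α β k : HalfLine →ₗ[ℂ] HalfLine) z)} =
        (fun θ : ℝ => Complex.exp (Complex.I * θ)) '' bands α β k ∧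
      {z ∈ pointSpectrum (cmvAt α β k) | FiniteDimensional ℂ (Module.End.eigenspace
            (cmvAt α β k : HalfLine →ₗ[ℂ] HalfLine) z)} =
        {z : ℂ | Real.sin (α + β) ≠ 0 ∧ k ≠ Real.pi / 2 ∧ k ≠ 3 * Real.pi / 2 ∧
          z = Complex.exp (Complex.I * theta0 α β k)} := by
  have hρ : √(1 - ‖eta α β k‖ ^ 2) = 0 := by simp [hη]
  have hC := cmvAt_isAlternatingCMV α β k
  rw [hρ] at hC
  have hp := hC.pointSpectrum_eq_degenerate
  have hfd : ∀ z, FiniteDimensional ℂ (Module.End.eigenspace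
      (cmvAt α β k : HalfLine →ₗ[ℂ] HalfLine) z) ↔ z ^ 2 ≠ -1 := fun z =>
    ⟨fun h hz => hC.not_finiteDimensional_eigenspace_degenerate hz h,
      hC.finiteDimensional_eigenspace_degenerate⟩
  have hc := hC.continuousSpectrum_eq_empty_degenerate
  refine ⟨hc, by rw [hC.spectrum_eq, hc, empty_union], ?_, ?_⟩
  · rw [image_bands, hρ, hp]
    ext z
    simp only [mem_ofPred_eq, hfd, not_not, ← sq_eq_neg_one_iff]
    tauto
  · rw [hp]
    ext z
    simp only [mem_ofPred_eq, hfd]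
    rw [← edge_condition_iff hk]
    constructor
    · rintro ⟨h1 | rfl, h2⟩
      · exact absurd h1 h2
      · have h3 : ‖star (eta α β k)‖ = 1 := by rw [norm_star, hη]
        refine ⟨h3, by simp, ?_⟩
        have h4 : (eta α β k).re ≠ 0 := by
          intro h0
          exact h2 (sq_eq_neg_one_iff.2 ⟨h3, by simp [h0]⟩)
        have : 0 < (eta α β k).re * (eta α β k).re := mul_self_pos.2 h4
        simpa using this
    · intro h
      have h4 : (eta α β k).re ≠ 0 := by
        intro h0
        simp [h0] at h
      have h3 : ‖star (eta α β k)‖ = 1 := by rw [norm_star, hη]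
      -- When `|η| = 1`, `star η` itself satisfies the edge conditions, so it is the point at angle
      -- `θ_0`.
      have h5 : z = star (eta α β k) := by
        rw [(eq_exp_theta0_iff h4).2 h, eq_comm, eq_exp_theta0_iff h4]
        refine ⟨h3, by simp, ?_⟩
        have : 0 < (eta α β k).re * (eta α β k).re := mul_self_pos.2 h4
        simpa using this
      refine ⟨Or.inr h5, fun h6 => ?_⟩
      have h7 := abs_nonpos_iff.1 (sq_eq_neg_one_iff.1 h6).2
      simp [h7] at h

end AEWalk

theorem theorem2 (α β : ℝ) :
    -- the dispersion relation for bulk states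
    AEWalk.Bu α β =
        {p : ℝ × ℝ | p.1 ∈ AEWalk.regularWaveNumbers α β ∧
          p.2 ∈ AEWalk.bands α β p.1 ∩ Set.Ico 0 (2 * Real.pi)} ∧
    -- the dispersion relation for edge states
    (Real.sin (α + β) ≠ 0 →
      AEWalk.Ed α β =
        {p : ℝ × ℝ | ∃ k ∈ AEWalk.regularWaveNumbers α β \ {Real.pi / 2, 3 * Real.pi / 2},
          p = (k, AEWalk.angleRep (AEWalk.theta0 α β k))}) ∧
    (Real.sin (α + β) = 0 → AEWalk.Ed α β = ∅) ∧
    -- the spectral decomposition at a wave number with `|η(k)| < 1`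
    (∀ k ∈ AEWalk.regularWaveNumbers α β,
      spectrum ℂ (AEWalk.cmvAt α β k) =
        AEWalk.continuousSpectrum (AEWalk.cmvAt α β k) ∪
          AEWalk.pointSpectrum (AEWalk.cmvAt α β k) ∧
      AEWalk.continuousSpectrum (AEWalk.cmvAt α β k) =
        (fun θ : ℝ => Complex.exp (Complex.I * θ)) '' AEWalk.bands α β k ∧
      AEWalk.pointSpectrum (AEWalk.cmvAt α β k) =
        {z : ℂ | Real.sin (α + β) ≠ 0 ∧ k ≠ Real.pi / 2 ∧ k ≠ 3 * Real.pi / 2 ∧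
          z = Complex.exp (Complex.I * AEWalk.theta0 α β k)}) ∧
    -- the degenerate wave numbers `|η(k)| = 1`: the bands shrink to the points `π/2`, `3π/2`,
    -- which are eigenvalues of infinite multiplicity;
    -- the edge state is the only eigenvalue of finite multiplicity
    (∀ k ∈ Set.Ico 0 (2 * Real.pi), ‖AEWalk.eta α β k‖ = 1 →
      AEWalk.continuousSpectrum (AEWalk.cmvAt α β k) = ∅ ∧
      spectrum ℂ (AEWalk.cmvAt α β k) = AEWalk.pointSpectrum (AEWalk.cmvAt α β k) ∧
      {z ∈ AEWalk.pointSpectrum (AEWalk.cmvAt α β k) |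
          ¬ FiniteDimensional ℂ (Module.End.eigenspace
            (AEWalk.cmvAt α β k : AEWalk.HalfLine →ₗ[ℂ] AEWalk.HalfLine) z)} =
        (fun θ : ℝ => Complex.exp (Complex.I * θ)) '' AEWalk.bands α β k ∧
      {z ∈ AEWalk.pointSpectrum (AEWalk.cmvAt α β k) |
          FiniteDimensional ℂ (Module.End.eigenspace
            (AEWalk.cmvAt α β k : AEWalk.HalfLine →ₗ[ℂ] AEWalk.HalfLine) z)} =
        {z : ℂ | Real.sin (α + β) ≠ 0 ∧ k ≠ Real.pi / 2 ∧ k ≠ 3 * Real.pi / 2 ∧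
          z = Complex.exp (Complex.I * AEWalk.theta0 α β k)}) := by
  refine ⟨AEWalk.Bu_eq α β, AEWalk.Ed_eq, AEWalk.Ed_eq_empty, fun k hk => ?_,
    fun k hk => AEWalk.degenerate_spectrum hk⟩
  exact ⟨(AEWalk.cmvAt_isAlternatingCMV α β k).spectrum_eq,
    AEWalk.continuousSpectrum_cmvAt hk, AEWalk.pointSpectrum_cmvAt hk⟩
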